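/- Let $\mathcal H$ be a real separable Hilbert space of dimension $d\in\{1,2,\dots\}\cup\{\infty\}$, let $\mathcal D$ be a probability distribution of pairs $(\mathbf x,y)\in\mathcal H\times\mathbb R$ with $\mathbb E[y^2]<\infty$, and let $L(\mathbf w)=\frac12\mathbb E_{(\mathbf x,y)\sim\mathcal D}[(y-\langle\mathbf w,\mathbf x\rangle)^2]$. Assume: (i) the covariance $\mathbf H=\mathbb E[\mathbf x\mathbf x^\top]$ exists, has finite trace and is positive definite, it is $\mathbf H=\mathrm{diag}(\lambda_1,\lambda_2,\dots)$ in an orthonormal basis of $\mathcal H$, with $\lambda_1\ge\lambda_2\ge\cdots$, and $L$ has a (necessarily unique) minimizer $\mathbf w_*$; the coordinates $v_i$ of $\mathbf v\in\mathcal H$ refer to this basis; (ii) $\mathbb E\|\mathbf x\|^4<\infty$, and $\psi>0$ is such that $\mathbb E[\mathbf x\mathbf x^\top\mathbf A\mathbf x\mathbf x^\top]\preceq\psi\,\mathrm{tr}(\mathbf H\mathbf A)\,\mathbf H$ for every bounded positive semidefinite operator $\mathbf A$; (iii) with $\xi=y-\langle\mathbf w_*,\mathbf x\rangle$, the operator $\boldsymbol\Sigma=\mathbb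 E[\xi^2\mathbf x\mathbf x^\top]$ exists, and $\sigma^2=\|\mathbf H^{-1/2}\boldsymbol\Sigma\mathbf H^{-1/2}\|_2$ is finite. Let $B\ge1$ and $N\ge1$ be integers, $\alpha\in(0,1)$, $0<\delta<\min\{B/(2\psi\,\mathrm{tr}(\mathbf H)),\,1/\|\mathbf H\|_2\}$ and $\mathbf w_0\in\mathcal H$. Let $(\mathbf x_{t,i},y_{t,i})$, $t\ge1$, $1\le i\le B$, be independent samples from $\mathcal D$, and let $$\mathbf w_t=\mathbf w_{t-1}+\frac\delta B\sum_{i=1}^B(y_{t,i}-\langle\mathbf w_{t-1},\mathbf x_{t,i}\rangle)\mathbf x_{t,i},\qquad \overline{\mathbf w}_N=\alpha^N\mathbf w_0+(1-\alpha)\sum_{t=0}^{N-1}\alpha^{N-1-t}\mathbf w_t .$$ Put $k^*=\max\{i:\lambda_i\ge(1-\alpha)/\delta\}$ and $k^\dagger=\max\{i:\lambda_i\ge1/(N\delta)\}$ (with $\max\emptyset=0$), $\|\mathbf v\|^2_{\mathbf I_{0:k}}=\sum_{i\le k}v_i^2$ and $\|\mathbf v\|^2_{\mathbf H_{k:\infty}}=\sum_{i>k}\lambda_iv_i^2$.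 Then $L(\overline{\mathbf w}_N)$ is integrable and $$\mathbb E[L(\overline{\mathbf w}_N)]-L(\mathbf w_*)\le\mathrm{EffectiveBias}+\mathrm{EffectiveVar},$$ where $$\mathrm{EffectiveBias}=\sum_i(\mathbf w_0-\mathbf w_*)_i^2\,\lambda_i\,b_i^2,\qquad b_i=\frac{(\delta\lambda_i)\alpha^N-(1-\alpha)(1-\delta\lambda_i)^N}{\delta\lambda_i-(1-\alpha)}$$ (if $\delta\lambda_i=1-\alpha$, then $b_i$ is the limit $\alpha^N+N(1-\alpha)\alpha^{N-1}$ of this quotient), and $$\mathrm{EffectiveVar}\le\bigg[k^*(1-\alpha)^2+\delta^2\sum_{i>k^*}\lambda_i^2\bigg]\cdot\frac{2\psi\big(\|\mathbf w_0-\mathbf w_*\|^2_{\mathbf I_{0:k^\dagger}}+N\delta\|\mathbf w_0-\mathbf w_*\|^2_{\mathbf H_{k^\dagger:\infty}}\big)}{\delta B}+\frac{2\sigma^2}{B}\bigg[(1-\alpha)k^*+\delta\sum_{i=k^*+1}^{k^\dagger}\lambda_i+N\delta^2\sum_{i>k^\dagger}\lambda_i^2\bigg],$$ where the middle sum is empty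 if $k^*\ge k^\dagger$. -/

import Mathlib

open MeasureTheory ProbabilityTheory InnerProductSpace
open scoped RealInnerProductSpace

noncomputable section

namespace EMASGD

/-- The coordinates `1, …, d` if `d` is finite, and `1, 2, 3, …` if `d = ⊤`. -/
abbrev Coord (d : ℕ∞) : Type := {i : ℕ // 1 ≤ i ∧ (i : ℕ∞) ≤ d}

variable {E : Type*} [NormedAddCommGroup E] [InnerProductSpace ℝ E] [MeasurableSpace E]
variable {d : ℕ∞}

/-! ### Least squares: risk, moments, noise

A sample is a pair `z = (x, y)` in `E × ℝ`, and `D` is the distribution of the samples. -/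

/-- The risk `L(w) = 1/2 · 𝔼 (y - ⟨w, x⟩)²`. -/
def risk (D : Measure (E × ℝ)) (w : E) : ℝ :=
  1 / 2 * ∫ z, (z.2 - ⟪w, z.1⟫) ^ 2 ∂D

/-- `w` minimizes the risk. -/
def IsMinimizer (D : Measure (E × ℝ)) (w : E) : Prop :=
  ∀ v : E, risk D w ≤ risk D v

/-- The covariance operator `H = 𝔼[x xᵀ]`. -/
def covOp (D : Measure (E × ℝ)) : E →L[ℝ] E :=
  ∫ z, rankOne ℝ z.1 z.1 ∂D

/-- The action `M ∘ A = 𝔼[x xᵀ A x xᵀ]` of the fourth moment operator on an operator `A`. -/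
def fourthMoment (D : Measure (E × ℝ)) (A : E →L[ℝ] E) : E →L[ℝ] E :=
  ∫ z, rankOne ℝ z.1 z.1 ∘L A ∘L rankOne ℝ z.1 z.1 ∂D

/-- The label noise `ξ = y - ⟨w, x⟩` of a sample at `w`. -/
def noise (w : E) (z : E × ℝ) : ℝ := z.2 - ⟪w, z.1⟫

/-- The covariance `Σ = 𝔼[ξ² x xᵀ]` of the stochastic gradient at `w`. -/
def noiseCov (D : Measure (E × ℝ)) (w : E) : E →L[ℝ] E :=
  ∫ z, noise w z ^ 2 • rankOne ℝ z.1 z.1 ∂D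

/-- The trace of an operator, computed in the basis `b`. -/
def trace (b : HilbertBasis (Coord d) ℝ E) (A : E →L[ℝ] E) : ℝ :=
  ∑' i, ⟪b i, A (b i)⟫

/-- Second moment condition: `H` exists, is `diag(λ₁, λ₂, …)` in the basis `b` with eigenvalues in
descending order, has finite trace, and is positive definite. -/
structure SecondMomentCondition (D : Measure (E × ℝ)) (b : HilbertBasis (Coord d) ℝ E)
    (lam : Coord d → ℝ) : Prop where
  integrable : Integrable (fun z : E × ℝ => rankOne ℝ z.1 z.1) D
  diagonal : ∀ i, covOp D (b i) = lam i • b i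
  antitone : Antitone lam
  summable : Summable lam
  pos_def : ∀ v : E, v ≠ 0 → 0 < ⟪v, covOp D v⟫

/-- Fourth moment condition, upper bound: the fourth moment is finite, and
`M ∘ A ≼ ψ tr(H A) H` for every bounded PSD operator `A`. -/
structure FourthMomentCondition (D : Measure (E × ℝ)) (b : HilbertBasis (Coord d) ℝ E)
    (ψ : ℝ) : Prop where
  integrable : Integrable (fun z : E × ℝ => ‖z.1‖ ^ 4) D
  upper : ∀ A : E →L[ℝ] E, A.IsPositive →
    ((ψ * trace b (covOp D ∘L A)) • covOp D - fourthMoment D A).IsPositive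

/-- Weak label noise condition: `Σ` exists, and `H^{-1/2} Σ H^{-1/2}`, where
`H^{-1/2} = diag(λ₁^{-1/2}, λ₂^{-1/2}, …)`, is (the matrix of) a bounded operator, of operator
norm `σ²`. -/
structure WeakNoiseCondition (D : Measure (E × ℝ)) (b : HilbertBasis (Coord d) ℝ E)
    (lam : Coord d → ℝ) (wstar : E) (σ : ℝ) : Prop where
  integrable : Integrable (fun z : E × ℝ => noise wstar z ^ 2 • rankOne ℝ z.1 z.1) D
  whitened : ∃ T : E →L[ℝ] E,
    (∀ i j, ⟪b i, T (b j)⟫ =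
      (√(lam i))⁻¹ * ⟪b i, noiseCov D wstar (b j)⟫ * (√(lam j))⁻¹) ∧
    ‖T‖ = σ ^ 2

/-! ### Mini-batch SGD with exponential moving average -/

/-- The mini-batch SGD iterates, where `s (t, i)` is the `i`-th sample of the mini-batch observed
at iteration `t ≥ 1`. -/
def sgdIterate {B : ℕ} (δ : ℝ) (w₀ : E) (s : ℕ × Fin B → E × ℝ) : ℕ → E
  | 0 => w₀
  | t + 1 => sgdIterate δ w₀ s t + (δ / B) • ∑ i : Fin B,
      ((s (t + 1, i)).2 - ⟪sgdIterate δ w₀ s t, (s (t + 1, i)).1⟫) • (s (t + 1, i)).1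

/-- The exponential moving average of the first `N` iterates. -/
def emaIterate {B : ℕ} (δ α : ℝ) (w₀ : E) (s : ℕ × Fin B → E × ℝ) (N : ℕ) : E :=
  α ^ N • w₀ + (1 - α) • ∑ t ∈ Finset.range N, α ^ (N - 1 - t) • sgdIterate δ w₀ s t

/-! ### The quantities in the bound -/

/-- `max {i : λᵢ ≥ c}`, which is `0` if there is no such `i`. -/
def cutoff (lam : Coord d → ℝ) (c : ℝ) : ℕ :=
  sSup {k : ℕ | ∃ i : Coord d, (i : ℕ) = k ∧ c ≤ lam i}

/-- `k* = max {i : λᵢ ≥ (1 - α) / δ}`. -/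
def kStar (lam : Coord d → ℝ) (δ α : ℝ) : ℕ := cutoff lam ((1 - α) / δ)

/-- `k† = max {i : λᵢ ≥ 1 / (N δ)}`. -/
def kDagger (lam : Coord d → ℝ) (δ : ℝ) (N : ℕ) : ℕ := cutoff lam (1 / (N * δ))

/-- `‖v‖²` in the seminorm of `I_{0:k}`, the sum of `vᵢ²` over `i ≤ k`. -/
def headNormSq (b : HilbertBasis (Coord d) ℝ E) (k : ℕ) (v : E) : ℝ :=
  ∑' i : {i : Coord d // (i : ℕ) ≤ k}, ⟪b i, v⟫ ^ 2

/-- `‖v‖²` in the seminorm of `H_{k:∞}`, the sum of `λᵢ vᵢ²` over `i > k`. -/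
def tailNormSq (b : HilbertBasis (Coord d) ℝ E) (lam : Coord d → ℝ) (k : ℕ) (v : E) : ℝ :=
  ∑' i : {i : Coord d // k < (i : ℕ)}, lam i * ⟪b i, v⟫ ^ 2

open Classical in
/-- The decay rate `bᵢ` as a function of `l = λᵢ`. Where the quotient is `0 / 0`, it stands for
its limit. -/
def decayRate (δ α : ℝ) (N : ℕ) (l : ℝ) : ℝ :=
  if δ * l = 1 - α then α ^ N + N * (1 - α) * α ^ (N - 1)
  else (δ * l * α ^ N - (1 - α) * (1 - δ * l) ^ N) / (δ * l - (1 - α))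

/-- The effective bias, for `v = w₀ - w_*`. -/
def effectiveBias (b : HilbertBasis (Coord d) ℝ E) (lam : Coord d → ℝ) (δ α : ℝ) (N : ℕ)
    (v : E) : ℝ :=
  ∑' i, ⟪b i, v⟫ ^ 2 * lam i * decayRate δ α N (lam i) ^ 2

/-- The bound on the effective variance with batch size `B`, for `v = w₀ - w_*`. -/
def effectiveVarBound (b : HilbertBasis (Coord d) ℝ E) (lam : Coord d → ℝ) (δ α ψ σ : ℝ)
    (N B : ℕ) (v : E) : ℝ :=
  (kStar lam δ α * (1 - α) ^ 2
      + δ ^ 2 * ∑' i : {i : Coord d // kStar lam δ α < (i : ℕ)}, lam i ^ 2)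
    * (2 * ψ * (headNormSq b (kDagger lam δ N) v
        + N * δ * tailNormSq b lam (kDagger lam δ N) v) / (δ * B))
  + 2 * σ ^ 2 / B * ((1 - α) * kStar lam δ α
      + δ * ∑' i : {i : Coord d // kStar lam δ α < (i : ℕ) ∧ (i : ℕ) ≤ kDagger lam δ N}, lam i
      + N * δ ^ 2 * ∑' i : {i : Coord d // kDagger lam δ N < (i : ℕ)}, lam i ^ 2)

end EMASGD

end

/-! The error `v_t = w_t - w_*` is SGD for labels of mean-zero correlation with the features, since
minimality makes the noise at `w_*` orthogonal to them. In an eigen-coordinate `i` it obeys a scalar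
recursion with contraction `1 - δ λ_i`, driven by innovations that have mean zero given the past.

Given the history up to time `s`, the conditional mean of the `i`-th coordinate of the averaged
error `n` steps later is `α ^ n` times the current averaged error plus `emaWeight α (1 - δ λ_i) n`
times `v_s`. Following this martingale from `s = 0` to `s = N` (`integral_ema_sq_le`), its initial
value gives exactly the decay rate `b_i` (`decayRate_eq`), and the innovations of step `r` add a
variance weighted by the square of `emaWeight` at `N - 1 - r`. Independence inside a batch makes
this variance scale as `1 / B`.

The second moment of a stochastic gradient coordinate is controlled by splitting `v_t` into a
noise-free part started at `w₀ - w_*` and a noise-driven part started at `0`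
(`integral_inner_gradientStep_sq_le`). The noise-driven part stays so small that it at most doubles
the gradient noise (`noise_risk_le`); the accumulated risk of the noise-free part is bounded by the
initial error, since for the allowed step sizes its self-induced fluctuations are absorbed by half
of the left side (`sum_noiseless_risk_le`).

What remains is elementary: with `p = δ λ_i`, `p * emaWeight` is at most `1 - α` and at most `p`,
and the sum of its squares is at most `1 - α`, `p` and `N p ^ 2`. Summing over `i` in
`half_integral_risk_le` works for any two cutoffs; `k*` and `k†` mark where the bounds cross. -/

noncomputable section

namespace EMASGD

variable {E : Type*} [NormedAddCommGroup E] [InnerProductSpace ℝ E] [MeasurableSpace E]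
variable {d : ℕ∞} {D : Measure (E × ℝ)} {b : HilbertBasis (Coord d) ℝ E} {lam : Coord d → ℝ}

/-! ### Moments of the data distribution -/

theorem SecondMomentCondition.integrable_norm_sq (h : SecondMomentCondition D b lam) :
    Integrable (fun z : E × ℝ => ‖z.1‖ ^ 2) D := by
  refine h.integrable.norm.congr (.of_forall fun z => ?_)
  simp [sq]

theorem inner_covOp [CompleteSpace E] (h : Integrable (fun z : E × ℝ => rankOne ℝ z.1 z.1) D)
    (u v : E) : ⟪u, covOp D v⟫ = ∫ z, ⟪u, z.1⟫ * ⟪v, z.1⟫ ∂D := by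
  rw [covOp, ContinuousLinearMap.integral_apply h, ← integral_inner (h.apply_continuousLinearMap v)]
  refine integral_congr_ae (.of_forall fun z => ?_)
  simp only [rankOne_apply, real_inner_smul_right, real_inner_comm z.1 v]
  ring

theorem SecondMomentCondition.inner_basis_covOp [CompleteSpace E]
    (h : SecondMomentCondition D b lam) (i : Coord d) (v : E) :
    ⟪b i, covOp D v⟫ = lam i * ⟪b i, v⟫ := by
  have : ⟪b i, covOp D v⟫ = ⟪v, covOp D (b i)⟫ := by
    rw [inner_covOp h.integrable, inner_covOp h.integrable]
    exact integral_congr_ae (.of_forall fun z => mul_comm _ _)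
  rw [this, h.diagonal, real_inner_smul_right, real_inner_comm]

theorem SecondMomentCondition.integral_inner_mul_inner [CompleteSpace E]
    (h : SecondMomentCondition D b lam) (i : Coord d) (v : E) :
    ∫ z, ⟪v, z.1⟫ * ⟪b i, z.1⟫ ∂D = lam i * ⟪b i, v⟫ := by
  rw [← h.inner_basis_covOp, inner_covOp h.integrable]
  exact integral_congr_ae (.of_forall fun z => mul_comm _ _)

theorem SecondMomentCondition.lam_pos (h : SecondMomentCondition D b lam) (i : Coord d) :
    0 < lam i := by
  have h0 : b i ≠ 0 := norm_ne_zero_iff.1 (by simp [b.orthonormal.1 i])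
  have := h.pos_def (b i) h0
  rwa [h.diagonal, real_inner_smul_right, real_inner_self_eq_norm_sq, b.orthonormal.1 i, one_pow,
    mul_one] at this

theorem SecondMomentCondition.lam_le_norm (h : SecondMomentCondition D b lam) (i : Coord d) :
    lam i ≤ ‖covOp D‖ := by
  have := (covOp D).le_opNorm (b i)
  rwa [h.diagonal, norm_smul, b.orthonormal.1 i, mul_one, mul_one, Real.norm_of_nonneg
    (h.lam_pos i).le] at this

theorem SecondMomentCondition.trace_covOp (h : SecondMomentCondition D b lam) :
    trace b (covOp D) = ∑' i, lam i := by
  refine tsum_congr fun i => ?_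
  rw [h.diagonal, real_inner_smul_right, real_inner_self_eq_norm_sq, b.orthonormal.1 i, one_pow,
    mul_one]

theorem SecondMomentCondition.hasSum_inner_covOp [CompleteSpace E]
    (h : SecondMomentCondition D b lam) (v : E) :
    HasSum (fun i => lam i * ⟪b i, v⟫ ^ 2) ⟪v, covOp D v⟫ := by
  refine (b.hasSum_inner_mul_inner v (covOp D v)).congr_fun fun i => ?_
  rw [h.inner_basis_covOp, real_inner_comm]
  ring

theorem SecondMomentCondition.inner_covOp_nonneg (h : SecondMomentCondition D b lam) (v : E) :
    0 ≤ ⟪v, covOp D v⟫ := by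
  rcases eq_or_ne v 0 with rfl | hv
  · simp
  · exact (h.pos_def v hv).le

theorem trace_comp_rankOne [CompleteSpace E] (h : SecondMomentCondition D b lam) (v : E) :
    trace b (covOp D ∘L rankOne ℝ v v) = ⟪v, covOp D v⟫ := by
  rw [trace, ← (h.hasSum_inner_covOp v).tsum_eq]
  refine tsum_congr fun i => ?_
  rw [ContinuousLinearMap.comp_apply, rankOne_apply, map_smul, real_inner_smul_right,
    h.inner_basis_covOp, real_inner_comm v]
  ring

/-- A diagonal entry of the whitened operator is at most its norm `σ ^ 2`; undoing the whitening
multiplies it by `λ_i`. -/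
theorem WeakNoiseCondition.integral_le {w : E} {σ : ℝ} [CompleteSpace E] (hs : SecondMomentCondition D b lam)
    (h : WeakNoiseCondition D b lam w σ) (i : Coord d) :
    ∫ z, (noise w z * ⟪b i, z.1⟫) ^ 2 ∂D ≤ σ ^ 2 * lam i := by
  obtain ⟨T, hT, hσ⟩ := h.whitened
  have hl := hs.lam_pos i
  have h1 : ⟪b i, T (b i)⟫ ≤ σ ^ 2 := by
    calc ⟪b i, T (b i)⟫ ≤ ‖b i‖ * ‖T (b i)‖ := real_inner_le_norm _ _
      _ ≤ ‖b i‖ * (‖T‖ * ‖b i‖) := by gcongr; exact T.le_opNorm _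
      _ = _ := by rw [b.orthonormal.1 i, hσ]; ring
  have heq : ∫ z, (noise w z * ⟪b i, z.1⟫) ^ 2 ∂D = ⟪b i, noiseCov D w (b i)⟫ := by
    rw [noiseCov, ContinuousLinearMap.integral_apply h.integrable,
      ← integral_inner (h.integrable.apply_continuousLinearMap _)]
    refine integral_congr_ae (.of_forall fun z => ?_)
    simp only [smul_apply, rankOne_apply, real_inner_smul_right,
      real_inner_comm (b i) z.1]
    ring
  rw [hT, ← heq, mul_right_comm, ← mul_inv, Real.mul_self_sqrt hl.le, inv_mul_le_iff₀ hl] at h1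
  linarith

theorem WeakNoiseCondition.integrable_sq_mul {w : E} {σ : ℝ}
    (h : WeakNoiseCondition D b lam w σ) :
    Integrable (fun z : E × ℝ => noise w z ^ 2 * ‖z.1‖ ^ 2) D := by
  refine h.integrable.norm.congr (.of_forall fun z => ?_)
  simp [norm_smul, sq]

section Measurability

variable [SecondCountableTopology E] [BorelSpace E]

theorem memLp_inner (h : Integrable (fun z : E × ℝ => ‖z.1‖ ^ 2) D) (u : E) :
    MemLp (fun z : E × ℝ => ⟪u, z.1⟫) 2 D :=
  MemLp.const_inner u ((memLp_two_iff_integrable_sq_norm (by fun_prop)).2 h)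

theorem memLp_noise (hy : Integrable (fun z : E × ℝ => z.2 ^ 2) D)
    (h : Integrable (fun z : E × ℝ => ‖z.1‖ ^ 2) D) (w : E) : MemLp (noise w) 2 D :=
  ((memLp_two_iff_integrable_sq (by fun_prop)).2 hy).sub (memLp_inner h w)

variable [CompleteSpace E]

/-- This is the operator inequality for the rank-one `A = u uᵀ`, tested at `b i`; then `tr(H A)` is
the quadratic form of `H` at `u`. -/
theorem FourthMomentCondition.integral_le {ψ : ℝ} (hs : SecondMomentCondition D b lam)
    (h : FourthMomentCondition D b ψ) (u : E) (i : Coord d) :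
    ∫ z, (⟪u, z.1⟫ * ⟪b i, z.1⟫) ^ 2 ∂D ≤ ψ * lam i * ⟪u, covOp D u⟫ := by
  have hpos := (h.upper _ (isPositive_rankOne_self u)).inner_nonneg_right (b i)
  have hint : Integrable
      (fun z : E × ℝ => rankOne ℝ z.1 z.1 ∘L rankOne ℝ u u ∘L rankOne ℝ z.1 z.1) D := by
    have hr : Continuous fun z : E × ℝ => rankOne ℝ z.1 z.1 :=
      (rankOne ℝ : E →L[ℝ] E →L⋆[ℝ] E →L[ℝ] E).continuous₂.comp
        (continuous_fst.prodMk continuous_fst)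
    refine (h.integrable.const_mul (‖u‖ ^ 2)).mono'
      (hr.clm_comp (continuous_const.clm_comp hr)).aestronglyMeasurable (.of_forall fun z => ?_)
    calc _ ≤ ‖rankOne ℝ z.1 z.1‖ * (‖rankOne ℝ u u‖ * ‖rankOne ℝ z.1 z.1‖) :=
          (ContinuousLinearMap.opNorm_comp_le _ _).trans
            (by gcongr; exact ContinuousLinearMap.opNorm_comp_le _ _)
      _ = ‖u‖ ^ 2 * ‖z.1‖ ^ 4 := by simp only [norm_rankOne]; ring
  rw [trace_comp_rankOne hs, sub_apply, inner_sub_right,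
    smul_apply, real_inner_smul_right, hs.inner_basis_covOp,
    real_inner_self_eq_norm_sq, b.orthonormal.1 i, fourthMoment,
    ContinuousLinearMap.integral_apply hint, ← integral_inner (hint.apply_continuousLinearMap _)]
    at hpos
  have heq : ∫ z, (⟪u, z.1⟫ * ⟪b i, z.1⟫) ^ 2 ∂D = ∫ z, ⟪b i,
      (rankOne ℝ z.1 z.1 ∘L rankOne ℝ u u ∘L rankOne ℝ z.1 z.1) (b i)⟫ ∂D := by
    refine integral_congr_ae (.of_forall fun z => ?_)
    simp only [ContinuousLinearMap.comp_apply, rankOne_apply, real_inner_smul_right,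
      real_inner_comm (b i) z.1, map_smul]
    rw [real_inner_comm u z.1]
    ring
  rw [heq]
  linarith

/-! ### The risk -/

theorem risk_add (hy : Integrable (fun z : E × ℝ => z.2 ^ 2) D)
    (h : SecondMomentCondition D b lam) (w u : E) :
    risk D (w + u) = risk D w - ∫ z, noise w z * ⟪u, z.1⟫ ∂D + 1 / 2 * ⟪u, covOp D u⟫ := by
  have hn := memLp_noise hy h.integrable_norm_sq w
  have hu := memLp_inner h.integrable_norm_sq u
  have h1 : Integrable (fun z : E × ℝ => noise w z * ⟪u, z.1⟫) D := hn.integrable_mul hu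
  have h2 : Integrable (fun z : E × ℝ => ⟪u, z.1⟫ * ⟪u, z.1⟫) D := hu.integrable_mul hu
  have heq : ∀ z : E × ℝ, (z.2 - ⟪w + u, z.1⟫) ^ 2
      = noise w z ^ 2 - 2 * (noise w z * ⟪u, z.1⟫) + ⟪u, z.1⟫ * ⟪u, z.1⟫ := by
    intro z
    rw [noise, inner_add_left]
    ring
  have h3 : Integrable
      (fun z : E × ℝ => noise w z ^ 2 - 2 * (noise w z * ⟪u, z.1⟫)) D :=
    hn.integrable_sq.sub (h1.const_mul 2)
  rw [risk, integral_congr_ae (.of_forall heq), integral_add h3 h2,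
    integral_sub hn.integrable_sq (h1.const_mul 2), integral_const_mul,
    ← inner_covOp h.integrable, risk]
  simp only [noise]
  ring

theorem IsMinimizer.integral_noise_mul_inner (hy : Integrable (fun z : E × ℝ => z.2 ^ 2) D)
    (h : SecondMomentCondition D b lam) {w : E} (hw : IsMinimizer D w) (u : E) :
    ∫ z, noise w z * ⟪u, z.1⟫ ∂D = 0 := by
  set I := ∫ z, noise w z * ⟪u, z.1⟫ ∂D with hI
  set Q := ⟪u, covOp D u⟫
  have key : ∀ t : ℝ, 0 ≤ - (t * I) + 1 / 2 * (t ^ 2 * Q) := by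
    intro t
    have h1 := hw (w + t • u)
    rw [risk_add hy h] at h1
    have h2 : ∫ z, noise w z * ⟪t • u, z.1⟫ ∂D = t * I := by
      rw [hI, ← integral_const_mul]
      refine integral_congr_ae (.of_forall fun z => ?_)
      simp only [real_inner_smul_left]
      ring
    rw [h2, map_smul, real_inner_smul_left, real_inner_smul_right] at h1
    linarith
  have hQ0 : 0 ≤ Q := h.inner_covOp_nonneg u
  -- The optimal `t` would be `I / Q`; the shift by `1` also covers `Q = 0` and still makes the
  -- quadratic negative unless `I = 0`.
  have h1 := key (I / (Q + 1))
  have h3 : -(I / (Q + 1) * I) + 1 / 2 * ((I / (Q + 1)) ^ 2 * Q)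
      = - (I ^ 2 * (Q + 2) / (2 * (Q + 1) ^ 2)) := by
    field_simp
    ring
  rw [h3] at h1
  by_contra hne
  have : 0 < I ^ 2 * (Q + 2) / (2 * (Q + 1) ^ 2) := by positivity
  linarith

theorem IsMinimizer.risk_eq (hy : Integrable (fun z : E × ℝ => z.2 ^ 2) D)
    (h : SecondMomentCondition D b lam) {w : E} (hw : IsMinimizer D w) (v : E) :
    risk D v = risk D w + 1 / 2 * ⟪v - w, covOp D (v - w)⟫ := by
  have := risk_add hy h w (v - w)
  rwa [hw.integral_noise_mul_inner hy h, add_sub_cancel, sub_zero] at this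

end Measurability

end EMASGD

namespace EMASGD

variable {E : Type*} [NormedAddCommGroup E] [InnerProductSpace ℝ E] [MeasurableSpace E]
variable {d : ℕ∞} {D : Measure (E × ℝ)} {b : HilbertBasis (Coord d) ℝ E} {lam : Coord d → ℝ}

/-! ### A single stochastic gradient step -/

/-- A noise model: square integrable against the features, and uncorrelated with them. -/
structure CenteredNoise (D : Measure (E × ℝ)) (ε : E × ℝ → ℝ) : Prop where
  measurable : Measurable ε
  integrable : Integrable (fun z : E × ℝ => ε z ^ 2 * ‖z.1‖ ^ 2) D
  integral_mul_inner : ∀ u : E, ∫ z, ε z * ⟪u, z.1⟫ ∂D = 0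

theorem centeredNoise_zero : CenteredNoise D (fun _ : E × ℝ => 0) where
  measurable := measurable_const
  integrable := by simp
  integral_mul_inner := by simp

/-- The negative stochastic gradient at `v` for labels `⟨0, x⟩ + ε`. -/
def gradientStep (ε : E × ℝ → ℝ) (v : E) (z : E × ℝ) : E := (ε z - ⟪v, z.1⟫) • z.1

/-- The centered `i`-th coordinate of the stochastic gradient step. -/
def innovation (b : HilbertBasis (Coord d) ℝ E) (lam : Coord d → ℝ) (ε : E × ℝ → ℝ) (i : Coord d)
    (v : E) (z : E × ℝ) : ℝ := ⟪b i, gradientStep ε v z⟫ + lam i * ⟪b i, v⟫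

/-! ### Fubini for independent random variables -/

section Product

variable {Ω S T : Type*} [MeasurableSpace Ω] [MeasurableSpace S] [MeasurableSpace T]
  {P : Measure Ω} [IsProbabilityMeasure P] {X : Ω → S} {Y : Ω → T}

theorem IndepFun.integral_comp_prodMk (hX : Measurable X) (hY : Measurable Y)
    (h : IndepFun X Y P) {F : S × T → ℝ} (hF : Measurable F)
    (hint : Integrable (fun ω => F (X ω, Y ω)) P) :
    Integrable (fun ω => ∫ y, F (X ω, y) ∂(P.map Y)) P ∧
      ∫ ω, F (X ω, Y ω) ∂P = ∫ ω, ∫ y, F (X ω, y) ∂(P.map Y) ∂P := by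
  have hmap := (indepFun_iff_map_prod_eq_prod_map_map hX.aemeasurable hY.aemeasurable).1 h
  have := Measure.isProbabilityMeasure_map (μ := P) hX.aemeasurable
  have := Measure.isProbabilityMeasure_map (μ := P) hY.aemeasurable
  have hint' : Integrable F ((P.map X).prod (P.map Y)) := by
    rw [← hmap]
    exact (integrable_map_measure hF.aestronglyMeasurable
      (hX.prodMk hY).aemeasurable).2 hint
  constructor
  · exact hint'.integral_prod_left.comp_measurable hX
  · rw [← integral_map (φ := fun ω => (X ω, Y ω)) (f := F) (hX.prodMk hY).aemeasurable
      hF.aestronglyMeasurable, hmap, integral_prod F hint',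
      integral_map hX.aemeasurable hint'.integral_prod_left.aestronglyMeasurable]

end Product

/-! ### Sigma-algebras generated by sets of samples -/

section History

variable {Ω ι F : Type*} [MeasurableSpace F] {Z : ι → Ω → F}

/-- The information in the samples with index in `S`. -/
abbrev history (Z : ι → Ω → F) (S : Set ι) : MeasurableSpace Ω :=
  ⨆ j ∈ S, MeasurableSpace.comap (Z j) inferInstance

theorem history_mono {S T : Set ι} (h : S ⊆ T) : history Z S ≤ history Z T :=
  biSup_mono h

theorem measurable_history {S : Set ι} {j : ι} (hj : j ∈ S) : Measurable[history Z S] (Z j) :=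
  (comap_measurable (Z j)).mono
    (le_iSup₂ (f := fun j (_ : j ∈ S) => MeasurableSpace.comap (Z j) inferInstance) j hj) le_rfl

variable [MeasurableSpace Ω] {P : Measure Ω}

theorem history_le (hZ : ∀ j, Measurable (Z j)) (S : Set ι) :
    history Z S ≤ ‹MeasurableSpace Ω› :=
  iSup₂_le fun j _ => (hZ j).comap_le

theorem indepFun_of_measurable_history (hZ : ∀ j, Measurable (Z j)) (hind : iIndepFun Z P)
    {S : Set ι} {j : ι} (hj : j ∉ S) {T : Type*} [MeasurableSpace T] {Y : Ω → T}
    (hY : Measurable[history Z S] Y) : IndepFun Y (Z j) P := by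
  have h := indep_iSup_of_disjoint (fun j => (hZ j).comap_le) hind
    (Set.disjoint_singleton_right.2 hj)
  simp only [Set.mem_singleton_iff, iSup_iSup_eq_left] at h
  exact (IndepFun_iff_Indep _ _ _).2 (indep_of_indep_of_le_left h hY.comap_le)

end History

/-! ### Moments of one stochastic gradient -/

variable [SecondCountableTopology E] [BorelSpace E]

theorem CenteredNoise.measurable_gradientStep {ε : E × ℝ → ℝ} (hε : CenteredNoise D ε) :
    Measurable fun p : E × (E × ℝ) => gradientStep ε p.1 p.2 := by
  have := hε.measurable
  unfold gradientStep
  fun_prop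

theorem CenteredNoise.measurable_innovation {ε : E × ℝ → ℝ} (hε : CenteredNoise D ε)
    (i : Coord d) : Measurable fun p : E × (E × ℝ) => innovation b lam ε i p.1 p.2 := by
  have := hε.measurable_gradientStep
  unfold innovation
  fun_prop

theorem CenteredNoise.memLp_smul {ε : E × ℝ → ℝ} (hε : CenteredNoise D ε) :
    MemLp (fun z : E × ℝ => ε z • z.1) 2 D := by
  have := hε.measurable
  refine (memLp_two_iff_integrable_sq_norm (by fun_prop)).2 (hε.integrable.congr ?_)
  refine .of_forall fun z => ?_
  simp only [norm_smul, mul_pow, Real.norm_eq_abs, sq_abs]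

theorem CenteredNoise.integral_innovation [CompleteSpace E] [IsProbabilityMeasure D]
    (hs : SecondMomentCondition D b lam) {ε : E × ℝ → ℝ} (hε : CenteredNoise D ε) (i : Coord d)
    (v : E) : ∫ z, innovation b lam ε i v z ∂D = 0 := by
  have h1 : Integrable (fun z : E × ℝ => ε z * ⟪b i, z.1⟫) D := by
    refine ((hε.memLp_smul.const_inner (b i)).integrable one_le_two).congr (.of_forall fun z => ?_)
    simp only [real_inner_smul_right]
  have h2 : Integrable (fun z : E × ℝ => ⟪v, z.1⟫ * ⟪b i, z.1⟫) D :=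
    (memLp_inner hs.integrable_norm_sq v).integrable_mul (memLp_inner hs.integrable_norm_sq (b i))
  have heq : ∀ z, innovation b lam ε i v z
      = ε z * ⟪b i, z.1⟫ - ⟪v, z.1⟫ * ⟪b i, z.1⟫ + lam i * ⟪b i, v⟫ := by
    intro z
    rw [innovation, gradientStep, real_inner_smul_right]
    ring
  have h3 : Integrable (fun z : E × ℝ => ε z * ⟪b i, z.1⟫ - ⟪v, z.1⟫ * ⟪b i, z.1⟫) D := h1.sub h2
  rw [integral_congr_ae (.of_forall heq), integral_add h3 (integrable_const _), integral_sub h1 h2,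
    hε.integral_mul_inner, hs.integral_inner_mul_inner]
  simp

variable {Ω : Type*} [MeasurableSpace Ω] {P : Measure Ω} {z : Ω → E × ℝ}
  {v : Ω → E} {U : Ω → ℝ} {ε : E × ℝ → ℝ}

theorem CenteredNoise.memLp_gradientStep (hε : CenteredNoise D ε)
    (h4 : Integrable (fun z : E × ℝ => ‖z.1‖ ^ 4) D) (hz : Measurable z) (hlaw : P.map z = D)
    (hvm : Measurable v) (hv : MemLp v 2 P) (hind : IndepFun v z P) :
    MemLp (fun ω => gradientStep ε (v ω) (z ω)) 2 P := by
  have h1 : MemLp (fun ω => ε (z ω) • (z ω).1) 2 P := by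
    have := hε.memLp_smul
    rw [← hlaw] at this
    exact this.comp_measurePreserving ⟨hz, rfl⟩
  have h2 : MemLp (fun ω => ⟪v ω, (z ω).1⟫ • (z ω).1) 2 P := by
    have hi : Integrable (fun ω => ‖v ω‖ ^ 2 * ‖(z ω).1‖ ^ 4) P := by
      have h3 : IndepFun (fun ω => ‖v ω‖ ^ 2) (fun ω => ‖(z ω).1‖ ^ 4) P :=
        hind.comp (φ := fun v : E => ‖v‖ ^ 2) (ψ := fun z : E × ℝ => ‖z.1‖ ^ 4)
          (by fun_prop) (by fun_prop)
      rw [← hlaw] at h4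
      exact h3.integrable_mul ((memLp_two_iff_integrable_sq_norm (by fun_prop)).1 hv)
        (h4.comp_measurable hz)
    refine (memLp_two_iff_integrable_sq_norm (by fun_prop)).2 (hi.mono' (by fun_prop) ?_)
    refine .of_forall fun ω => ?_
    rw [norm_pow, norm_norm, norm_smul, Real.norm_eq_abs]
    calc (|⟪v ω, (z ω).1⟫| * ‖(z ω).1‖) ^ 2 ≤ ((‖v ω‖ * ‖(z ω).1‖) * ‖(z ω).1‖) ^ 2 := by
          gcongr
          exact abs_real_inner_le_norm _ _
      _ = _ := by ring
  refine (h1.sub h2).congr_norm ?_ (.of_forall fun ω => ?_)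
  · exact (hε.measurable_gradientStep.comp (hvm.prodMk hz)).aestronglyMeasurable
  · simp only [Pi.sub_apply, gradientStep, sub_smul]

theorem CenteredNoise.memLp_innovation (hε : CenteredNoise D ε)
    (h4 : Integrable (fun z : E × ℝ => ‖z.1‖ ^ 4) D) (hz : Measurable z) (hlaw : P.map z = D)
    (hvm : Measurable v) (hv : MemLp v 2 P) (hind : IndepFun v z P) (i : Coord d) :
    MemLp (fun ω => innovation b lam ε i (v ω) (z ω)) 2 P := by
  have h1 : MemLp (fun ω => ⟪b i, gradientStep ε (v ω) (z ω)⟫) 2 P :=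
    (hε.memLp_gradientStep h4 hz hlaw hvm hv hind).const_inner (b i)
  have h2 : MemLp (fun ω => lam i * ⟪b i, v ω⟫) 2 P := (hv.const_inner (b i)).const_mul (lam i)
  exact h1.add h2

theorem integrable_inner_covOp (hvm : Measurable v) (hv : MemLp v 2 P) :
    Integrable (fun ω => ⟪v ω, covOp D (v ω)⟫) P := by
  have h := (memLp_two_iff_integrable_sq_norm (by fun_prop)).1 hv
  refine (h.const_mul ‖covOp D‖).mono' (by fun_prop) (.of_forall fun ω => ?_)
  rw [Real.norm_eq_abs]
  calc |⟪v ω, covOp D (v ω)⟫| ≤ ‖v ω‖ * ‖covOp D (v ω)‖ := abs_real_inner_le_norm _ _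
    _ ≤ ‖v ω‖ * (‖covOp D‖ * ‖v ω‖) := by gcongr; exact ContinuousLinearMap.le_opNorm _ _
    _ = _ := by ring

variable [CompleteSpace E] [IsProbabilityMeasure P]

/-- Integrating over the fresh sample first, with `U` and `v` frozen, leaves the mean of an
innovation at a fixed point, which is zero. -/
theorem CenteredNoise.integral_mul_innovation [IsProbabilityMeasure D]
    (hs : SecondMomentCondition D b lam) (hε : CenteredNoise D ε)
    (h4 : Integrable (fun z : E × ℝ => ‖z.1‖ ^ 4) D) (hz : Measurable z) (hlaw : P.map z = D)
    (hUm : Measurable U) (hU : MemLp U 2 P) (hvm : Measurable v) (hv : MemLp v 2 P)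
    (hind : IndepFun (fun ω => (U ω, v ω)) z P) (i : Coord d) :
    ∫ ω, U ω * innovation b lam ε i (v ω) (z ω) ∂P = 0 := by
  have hind' : IndepFun v z P := hind.comp measurable_snd measurable_id
  have hm := hε.measurable_innovation (b := b) (lam := lam) i
  have h := (IndepFun.integral_comp_prodMk (hUm.prodMk hvm) hz hind
    (F := fun p => p.1.1 * innovation b lam ε i p.1.2 p.2)
    (measurable_fst.fst.mul (hm.comp (measurable_fst.snd.prodMk measurable_snd)))
    (hU.integrable_mul (hε.memLp_innovation h4 hz hlaw hvm hv hind' i))).2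
  rw [h, hlaw]
  simp [integral_const_mul, hε.integral_innovation hs]

theorem CenteredNoise.integral_add_innovation_sq [IsProbabilityMeasure D]
    (hs : SecondMomentCondition D b lam) (hε : CenteredNoise D ε)
    (h4 : Integrable (fun z : E × ℝ => ‖z.1‖ ^ 4) D) (hz : Measurable z) (hlaw : P.map z = D)
    (hUm : Measurable U) (hU : MemLp U 2 P) (hvm : Measurable v) (hv : MemLp v 2 P)
    (hind : IndepFun (fun ω => (U ω, v ω)) z P) (i : Coord d) (a : ℝ) :
    ∫ ω, (U ω + a * innovation b lam ε i (v ω) (z ω)) ^ 2 ∂P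
      = ∫ ω, U ω ^ 2 ∂P + a ^ 2 * ∫ ω, innovation b lam ε i (v ω) (z ω) ^ 2 ∂P := by
  have hind' : IndepFun v z P := hind.comp measurable_snd measurable_id
  have hi := hε.memLp_innovation (b := b) (lam := lam) h4 hz hlaw hvm hv hind' i
  have h1 : Integrable (fun ω => U ω * innovation b lam ε i (v ω) (z ω)) P :=
    hU.integrable_mul hi
  have heq : ∀ ω, (U ω + a * innovation b lam ε i (v ω) (z ω)) ^ 2
      = (U ω ^ 2 + 2 * a * (U ω * innovation b lam ε i (v ω) (z ω)))
        + a ^ 2 * innovation b lam ε i (v ω) (z ω) ^ 2 := fun ω => by ring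
  have h2 : Integrable
      (fun ω => U ω ^ 2 + 2 * a * (U ω * innovation b lam ε i (v ω) (z ω))) P :=
    hU.integrable_sq.add (h1.const_mul _)
  rw [integral_congr_ae (.of_forall heq), integral_add h2 (hi.integrable_sq.const_mul _),
    integral_add hU.integrable_sq (h1.const_mul _), integral_const_mul, integral_const_mul,
    hε.integral_mul_innovation hs h4 hz hlaw hUm hU hvm hv hind]
  simp

/-- A variance is at most the second moment: the innovation is orthogonal to the drift, and the two
add up to the gradient coordinate. -/
theorem CenteredNoise.integral_innovation_sq_le [IsProbabilityMeasure D]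
    (hs : SecondMomentCondition D b lam) (hε : CenteredNoise D ε)
    (h4 : Integrable (fun z : E × ℝ => ‖z.1‖ ^ 4) D) (hz : Measurable z) (hlaw : P.map z = D)
    (hvm : Measurable v) (hv : MemLp v 2 P) (hind : IndepFun v z P) (i : Coord d) :
    ∫ ω, innovation b lam ε i (v ω) (z ω) ^ 2 ∂P
      ≤ ∫ ω, ⟪b i, gradientStep ε (v ω) (z ω)⟫ ^ 2 ∂P := by
  have hg : Measurable fun u : E => -(lam i * ⟪b i, u⟫) := by fun_prop
  have h := hε.integral_add_innovation_sq hs h4 hz hlaw (U := fun ω => -(lam i * ⟪b i, v ω⟫))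
    (hg.comp hvm) ((hv.const_inner (b i)).const_mul (lam i)).neg hvm hv
    (hind.comp (hg.prodMk measurable_id) measurable_id) i 1
  have heq : ∀ ω, -(lam i * ⟪b i, v ω⟫) + 1 * innovation b lam ε i (v ω) (z ω)
      = ⟪b i, gradientStep ε (v ω) (z ω)⟫ := fun ω => by rw [innovation]; ring
  simp only [heq] at h
  rw [h]
  have : 0 ≤ ∫ ω, (-(lam i * ⟪b i, v ω⟫)) ^ 2 ∂P := integral_nonneg fun ω => sq_nonneg _
  linarith

theorem integral_inner_gradientStep_zero_sq_le {ψ : ℝ} (hs : SecondMomentCondition D b lam)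
    (hf : FourthMomentCondition D b ψ) (hz : Measurable z) (hlaw : P.map z = D)
    (hvm : Measurable v) (hv : MemLp v 2 P) (hind : IndepFun v z P) (i : Coord d) :
    ∫ ω, ⟪b i, gradientStep (fun _ => 0) (v ω) (z ω)⟫ ^ 2 ∂P
      ≤ lam i * (ψ * ∫ ω, ⟪v ω, covOp D (v ω)⟫ ∂P) := by
  have hg := (centeredNoise_zero (D := D)).memLp_gradientStep hf.integrable hz hlaw hvm hv hind
  have hm := (centeredNoise_zero (D := D)).measurable_gradientStep
  have h := IndepFun.integral_comp_prodMk hvm hz hind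
    (F := fun p => ⟪b i, gradientStep (fun _ => 0) p.1 p.2⟫ ^ 2) (by fun_prop)
    (hg.const_inner (b i)).integrable_sq
  rw [h.2]
  calc _ ≤ ∫ ω, ψ * lam i * ⟪v ω, covOp D (v ω)⟫ ∂P := by
        refine integral_mono h.1 ((integrable_inner_covOp hvm hv).const_mul _) fun ω => ?_
        refine le_trans (le_of_eq ?_) (hf.integral_le hs (v ω) i)
        rw [hlaw]
        refine integral_congr_ae (.of_forall fun z => ?_)
        simp only [gradientStep, real_inner_smul_right]
        ring
    _ = _ := by rw [integral_const_mul]; ring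

/-- The noise and the feature may be dependent, so the cross term is killed by `hmean` instead: an
iterate with mean zero, independent of the sample, averages it out. -/
theorem CenteredNoise.integral_inner_gradientStep_sq_le {ψ σ : ℝ}
    (hs : SecondMomentCondition D b lam) (hf : FourthMomentCondition D b ψ)
    (hε : CenteredNoise D ε) (hσ : ∀ i, ∫ z, (ε z * ⟪b i, z.1⟫) ^ 2 ∂D ≤ σ ^ 2 * lam i)
    (hz : Measurable z) (hlaw : P.map z = D)
    (hvm : Measurable v) (hv : MemLp v 2 P) (hmean : ∫ ω, v ω ∂P = 0) (hind : IndepFun v z P)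
    (i : Coord d) :
    ∫ ω, ⟪b i, gradientStep ε (v ω) (z ω)⟫ ^ 2 ∂P
      ≤ lam i * (σ ^ 2 + ψ * ∫ ω, ⟪v ω, covOp D (v ω)⟫ ∂P) := by
  have hεm := hε.measurable
  have hg : MemLp (fun ω => ⟪b i, gradientStep (fun _ => 0) (v ω) (z ω)⟫) 2 P :=
    ((centeredNoise_zero (D := D)).memLp_gradientStep hf.integrable hz hlaw hvm hv
      hind).const_inner (b i)
  have hn : MemLp (fun z : E × ℝ => ε z * ⟪b i, z.1⟫) 2 D := by
    refine (MemLp.const_inner (𝕜 := ℝ) (b i) hε.memLp_smul).congr_norm (by fun_prop)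
      (.of_forall fun z => ?_)
    simp only [real_inner_smul_right]
  have hn' : MemLp (fun ω => ε (z ω) * ⟪b i, (z ω).1⟫) 2 P := by
    rw [← hlaw] at hn
    exact hn.comp_measurePreserving ⟨hz, rfl⟩
  have heq : ∀ ω, ⟪b i, gradientStep ε (v ω) (z ω)⟫ ^ 2
      = ((ε (z ω) * ⟪b i, (z ω).1⟫) ^ 2 + ⟪b i, gradientStep (fun _ => 0) (v ω) (z ω)⟫ ^ 2)
        + 2 * (ε (z ω) * ⟪b i, (z ω).1⟫
          * ⟪b i, gradientStep (fun _ => 0) (v ω) (z ω)⟫) := by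
    intro ω
    simp only [gradientStep, real_inner_smul_right]
    ring
  have hc : Integrable (fun ω => ε (z ω) * ⟪b i, (z ω).1⟫
      * ⟪b i, gradientStep (fun _ => 0) (v ω) (z ω)⟫) P := hn'.integrable_mul hg
  have hc0 : ∫ ω, ε (z ω) * ⟪b i, (z ω).1⟫
      * ⟪b i, gradientStep (fun _ => 0) (v ω) (z ω)⟫ ∂P = 0 := by
    have hm := (centeredNoise_zero (D := D)).measurable_gradientStep
    rw [(IndepFun.integral_comp_prodMk hz hvm hind.symm
      (F := fun p => ε p.1 * ⟪b i, p.1.1⟫ * ⟪b i, gradientStep (fun _ => 0) p.2 p.1⟫)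
      (by
        refine Measurable.mul (by fun_prop) ?_
        exact Measurable.const_inner (𝕜 := ℝ) (hm.comp measurable_swap)) hc).2]
    refine integral_eq_zero_of_ae (.of_forall fun ω => ?_)
    -- For a fixed sample the cross term is linear in the iterate, so its integral is an inner
    -- product with the mean of `v`.
    have h0 : ∀ v' : E, ε (z ω) * ⟪b i, (z ω).1⟫ * ⟪b i, gradientStep (fun _ => 0) v' (z ω)⟫
        = -(ε (z ω) * ⟪b i, (z ω).1⟫ ^ 2) * ⟪(z ω).1, v'⟫ := by
      intro v'
      rw [gradientStep, real_inner_smul_right, real_inner_comm v' (z ω).1]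
      ring
    simp only [h0, Pi.zero_apply]
    rw [integral_const_mul, integral_map hvm.aemeasurable (by fun_prop),
      integral_inner (hv.integrable one_le_two), hmean, inner_zero_right, mul_zero]
  have h2 : Integrable (fun ω => (ε (z ω) * ⟪b i, (z ω).1⟫) ^ 2
      + ⟪b i, gradientStep (fun _ => 0) (v ω) (z ω)⟫ ^ 2) P := hn'.integrable_sq.add hg.integrable_sq
  have h3 : ∫ ω, (ε (z ω) * ⟪b i, (z ω).1⟫) ^ 2 ∂P ≤ σ ^ 2 * lam i := by
    refine le_trans (le_of_eq ?_) (hσ i)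
    rw [← hlaw, integral_map hz.aemeasurable (by fun_prop)]
  rw [integral_congr_ae (.of_forall heq), integral_add h2 (hc.const_mul 2),
    integral_add hn'.integrable_sq hg.integrable_sq, integral_const_mul, hc0]
  have := integral_inner_gradientStep_zero_sq_le hs hf hz hlaw hvm hv hind i
  linarith

/-! ### Mini-batches -/

section Batch

variable {ι : Type*} {Z : ι → Ω → E × ℝ}

/-- Samples are added one at a time. Each is independent of the history enlarged by the earlier
samples of the batch, so cross terms vanish and the variances add: the factor is `T.card`, not its
square. -/
theorem CenteredNoise.batch [IsProbabilityMeasure D]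
    (hs : SecondMomentCondition D b lam) (hε : CenteredNoise D ε)
    (h4 : Integrable (fun z : E × ℝ => ‖z.1‖ ^ 4) D) (hZ : ∀ j, Measurable (Z j))
    (hlaw : ∀ j, P.map (Z j) = D) (hind : iIndepFun Z P) {S : Set ι}
    (hUm : Measurable[history Z S] U) (hU : MemLp U 2 P)
    (hvm : Measurable[history Z S] v) (hv : MemLp v 2 P) (i : Coord d) (a V : ℝ) (T : Finset ι)
    (hT : ∀ j ∈ T, j ∉ S) (hV : ∀ j ∈ T, ∫ ω, ⟪b i, gradientStep ε (v ω) (Z j ω)⟫ ^ 2 ∂P ≤ V) :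
    MemLp (fun ω => U ω + a * ∑ j ∈ T, innovation b lam ε i (v ω) (Z j ω)) 2 P ∧
    ∫ ω, U ω + a * ∑ j ∈ T, innovation b lam ε i (v ω) (Z j ω) ∂P = ∫ ω, U ω ∂P ∧
    ∫ ω, (U ω + a * ∑ j ∈ T, innovation b lam ε i (v ω) (Z j ω)) ^ 2 ∂P
      ≤ ∫ ω, U ω ^ 2 ∂P + a ^ 2 * (T.card * V) := by
  classical
  induction T using Finset.induction_on with
  | empty => simpa using hU
  | insert j T hjT ih =>
    obtain ⟨h1, h2, h3⟩ := ih (fun k hk => hT k (Finset.mem_insert_of_mem hk))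
      (fun k hk => hV k (Finset.mem_insert_of_mem hk))
    have hvm' : Measurable v := hvm.mono (history_le hZ S) le_rfl
    have hS : history Z S ≤ history Z (S ∪ T) := history_mono Set.subset_union_left
    have hWm : Measurable[history Z (S ∪ T)]
        fun ω => U ω + a * ∑ k ∈ T, innovation b lam ε i (v ω) (Z k ω) := by
      refine (hUm.mono hS le_rfl).add (Measurable.const_mul ?_ a)
      refine Finset.measurable_sum _ fun k hk => ?_
      exact (hε.measurable_innovation i).comp
        ((hvm.mono hS le_rfl).prodMk (measurable_history (Or.inr hk)))
    have hj : j ∉ S ∪ (T : Set ι) := by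
      rintro (h | h)
      · exact hT j (Finset.mem_insert_self j T) h
      · exact hjT h
    have hi := indepFun_of_measurable_history hZ hind hj (hWm.prodMk (hvm.mono hS le_rfl))
    have hi' : IndepFun v (Z j) P := hi.comp measurable_snd measurable_id
    have hWm' := hWm.mono (history_le hZ _) le_rfl
    have hinn := hε.memLp_innovation (b := b) (lam := lam) h4 (hZ j) (hlaw j) hvm' hv hi' i
    have heq : ∀ ω, U ω + a * ∑ k ∈ insert j T, innovation b lam ε i (v ω) (Z k ω)
        = (U ω + a * ∑ k ∈ T, innovation b lam ε i (v ω) (Z k ω))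
          + a * innovation b lam ε i (v ω) (Z j ω) := by
      intro ω
      rw [Finset.sum_insert hjT]
      ring
    simp only [heq]
    refine ⟨h1.add (hinn.const_mul a), ?_, ?_⟩
    · have h0 := hε.integral_mul_innovation hs h4 (hZ j) (hlaw j) (U := fun _ => 1)
        measurable_const (memLp_const 1) hvm' hv
        (hi'.comp (φ := fun v => ((1 : ℝ), v)) (by fun_prop) measurable_id) i
      simp only [one_mul] at h0
      rw [integral_add (h1.integrable one_le_two) ((hinn.const_mul a).integrable one_le_two),
        integral_const_mul, h0, h2]
      simp
    · rw [hε.integral_add_innovation_sq hs h4 (hZ j) (hlaw j) hWm' h1 hvm' hv hi,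
        Finset.card_insert_of_notMem hjT]
      have h5 := (hε.integral_innovation_sq_le hs h4 (hZ j) (hlaw j) hvm' hv hi' i).trans
        (hV j (Finset.mem_insert_self j T))
      have h6 := mul_le_mul_of_nonneg_left h5 (sq_nonneg a)
      push_cast
      linarith

end Batch

end EMASGD

namespace EMASGD

/-! ### Linear recursions -/

theorem add_mul_sum_le_of_le_recursion {e r : ℕ → ℝ} {p : ℝ}
    (h : ∀ t, e (t + 1) ≤ (1 - p) * e t + r t) (n : ℕ) :
    e n + p * ∑ t ∈ Finset.range n, e t ≤ e 0 + ∑ t ∈ Finset.range n, r t := by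
  induction n with
  | zero => simp
  | succ n ih =>
    rw [Finset.sum_range_succ, Finset.sum_range_succ]
    linarith [h n]

theorem mul_sum_le_of_le_recursion {e r : ℕ → ℝ} {p : ℝ} (he : ∀ t, 0 ≤ e t)
    (h : ∀ t, e (t + 1) ≤ (1 - p) * e t + r t) (n : ℕ) :
    p * ∑ t ∈ Finset.range n, e t ≤ e 0 + ∑ t ∈ Finset.range n, r t := by
  linarith [add_mul_sum_le_of_le_recursion h n, he n]

/-- Over a short horizon, the initial value enters a contracting recursion with weight `n p`. -/
theorem mul_sum_le_of_le_recursion_short {e r : ℕ → ℝ} {p : ℝ} (hp : 0 ≤ p) (hp1 : p ≤ 1)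
    (he0 : 0 ≤ e 0) (hr : ∀ t, 0 ≤ r t) (h : ∀ t, e (t + 1) ≤ (1 - p) * e t + r t) (n : ℕ) :
    p * ∑ t ∈ Finset.range n, e t ≤ n * p * e 0 + ∑ t ∈ Finset.range n, r t := by
  -- The positive part of `e t - e 0` starts at zero and obeys the same recursion, because the
  -- leftover `-p * e 0` only helps; the constant `e 0` accounts for the weight `n * p`.
  have h1 := mul_sum_le_of_le_recursion (e := fun t => max (e t - e 0) 0) (r := r) (p := p)
    (fun t => le_max_right _ _) (fun t => by
      have h2 := mul_le_mul_of_nonneg_left (le_max_left (e t - e 0) 0) (sub_nonneg.2 hp1)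
      have h3 := mul_nonneg (sub_nonneg.2 hp1) (le_max_right (e t - e 0) 0)
      refine max_le ?_ (by linarith [hr t])
      nlinarith [h t, mul_nonneg hp he0]) n
  have h2 : ∑ t ∈ Finset.range n, e t
      ≤ ∑ t ∈ Finset.range n, (e 0 + max (e t - e 0) 0) :=
    Finset.sum_le_sum fun t _ => by linarith [le_max_left (e t - e 0) 0]
  rw [Finset.sum_add_distrib, Finset.sum_const, Finset.card_range, nsmul_eq_mul] at h2
  have h3 := mul_le_mul_of_nonneg_left h2 hp
  simp only [sub_self, max_self, zero_add] at h1
  linarith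

/-! ### The weight of an iterate in later averages -/

/-- The coefficient of a coordinate contracting at rate `q` in the average `n` steps later. -/
def emaWeight (α q : ℝ) : ℕ → ℝ
  | 0 => 0
  | n + 1 => (1 - α) * α ^ n + q * emaWeight α q n

section Weight

variable {α q p : ℝ}

theorem emaWeight_nonneg (hα : α ∈ Set.Ioo (0 : ℝ) 1) (hq : 0 ≤ q) (n : ℕ) :
    0 ≤ emaWeight α q n := by
  induction n with
  | zero => exact le_rfl
  | succ n ih =>
    have := hα.1.le
    have := sub_nonneg.2 hα.2.le
    rw [emaWeight]
    positivity

theorem emaWeight_le (hα : α ∈ Set.Ioo (0 : ℝ) 1) (hq : 0 ≤ q) (hq1 : q ≤ 1) (n : ℕ) :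
    emaWeight α q n ≤ 1 - α ^ n := by
  induction n with
  | zero => simp [emaWeight]
  | succ n ih =>
    have := mul_le_of_le_one_left (emaWeight_nonneg hα hq n) hq1
    rw [emaWeight, pow_succ]
    linarith

theorem emaWeight_le_one (hα : α ∈ Set.Ioo (0 : ℝ) 1) (hq : 0 ≤ q) (hq1 : q ≤ 1) (n : ℕ) :
    emaWeight α q n ≤ 1 := by
  linarith [emaWeight_le hα hq hq1 n, pow_nonneg hα.1.le n]

/-- By the recursion, `p * emaWeight` at `n + 1` is at most a convex combination, with weights `p`
and `1 - p`, of `1 - α` and its value at `n`. -/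
theorem mul_emaWeight_le (hα : α ∈ Set.Ioo (0 : ℝ) 1) (hp : 0 ≤ p) (hp1 : p ≤ 1) (n : ℕ) :
    p * emaWeight α (1 - p) n ≤ 1 - α := by
  have h1 := sub_nonneg.2 hα.2.le
  induction n with
  | zero => simpa [emaWeight] using hα.2.le
  | succ n ih =>
    have h2 := mul_le_mul_of_nonneg_left ih (sub_nonneg.2 hp1)
    have h3 : (1 - α) * α ^ n ≤ 1 - α := mul_le_of_le_one_right h1 (pow_le_one₀ hα.1.le hα.2.le)
    have h4 := mul_le_mul_of_nonneg_left h3 hp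
    rw [emaWeight]
    linarith

theorem mul_sum_emaWeight_le (hα : α ∈ Set.Ioo (0 : ℝ) 1) (hp1 : p ≤ 1) (n : ℕ) :
    p * ∑ t ∈ Finset.range n, emaWeight α (1 - p) t ≤ 1 := by
  have h := mul_sum_le_of_le_recursion (e := emaWeight α (1 - p)) (r := fun t => (1 - α) * α ^ t)
    (p := p) (emaWeight_nonneg hα (sub_nonneg.2 hp1)) (fun t => by rw [emaWeight]; linarith) n
  rw [← Finset.mul_sum, mul_comm (1 - α), geom_sum_mul_neg, emaWeight, zero_add] at h
  linarith [pow_nonneg hα.1.le n]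

theorem mul_emaWeight_sq_le_sq (hα : α ∈ Set.Ioo (0 : ℝ) 1) (hp : 0 ≤ p) (hp1 : p ≤ 1) (n : ℕ) :
    (p * emaWeight α (1 - p) n) ^ 2 ≤ (1 - α) ^ 2 :=
  pow_le_pow_left₀ (mul_nonneg hp (emaWeight_nonneg hα (sub_nonneg.2 hp1) n))
    (mul_emaWeight_le hα hp hp1 n) 2

theorem mul_emaWeight_sq_le_rate_sq (hα : α ∈ Set.Ioo (0 : ℝ) 1) (hp : 0 ≤ p) (hp1 : p ≤ 1)
    (n : ℕ) : (p * emaWeight α (1 - p) n) ^ 2 ≤ p ^ 2 :=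
  pow_le_pow_left₀ (mul_nonneg hp (emaWeight_nonneg hα (sub_nonneg.2 hp1) n))
    (mul_le_of_le_one_right hp (emaWeight_le_one hα (sub_nonneg.2 hp1) (by linarith) n)) 2

/-- One factor of each square is bounded by `C`; the remaining sum is at most `1`, since the total
mass fed into the recursion is `1 - α ^ n`. -/
theorem sum_mul_emaWeight_sq_le (hα : α ∈ Set.Ioo (0 : ℝ) 1) (hp : 0 ≤ p) (hp1 : p ≤ 1) (n : ℕ)
    {C : ℝ} (hC0 : 0 ≤ C) (hC : ∀ t, p * emaWeight α (1 - p) t ≤ C) :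
    ∑ t ∈ Finset.range n, (p * emaWeight α (1 - p) t) ^ 2 ≤ C := by
  calc ∑ t ∈ Finset.range n, (p * emaWeight α (1 - p) t) ^ 2
      ≤ ∑ t ∈ Finset.range n, C * (p * emaWeight α (1 - p) t) := by
        refine Finset.sum_le_sum fun t _ => ?_
        rw [sq]
        exact mul_le_mul_of_nonneg_right (hC t)
          (mul_nonneg hp (emaWeight_nonneg hα (sub_nonneg.2 hp1) t))
    _ = C * (p * ∑ t ∈ Finset.range n, emaWeight α (1 - p) t) := by
        rw [← Finset.mul_sum, ← Finset.mul_sum]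
    _ ≤ C := mul_le_of_le_one_right hC0 (mul_sum_emaWeight_le hα hp1 n)

theorem sum_mul_emaWeight_sq_le_one_sub (hα : α ∈ Set.Ioo (0 : ℝ) 1) (hp : 0 ≤ p) (hp1 : p ≤ 1)
    (n : ℕ) : ∑ t ∈ Finset.range n, (p * emaWeight α (1 - p) t) ^ 2 ≤ 1 - α :=
  sum_mul_emaWeight_sq_le hα hp hp1 n (sub_nonneg.2 hα.2.le) (mul_emaWeight_le hα hp hp1)

theorem sum_mul_emaWeight_sq_le_rate (hα : α ∈ Set.Ioo (0 : ℝ) 1) (hp : 0 ≤ p) (hp1 : p ≤ 1)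
    (n : ℕ) : ∑ t ∈ Finset.range n, (p * emaWeight α (1 - p) t) ^ 2 ≤ p :=
  sum_mul_emaWeight_sq_le hα hp hp1 n hp fun t =>
    mul_le_of_le_one_right hp (emaWeight_le_one hα (sub_nonneg.2 hp1) (by linarith) t)

theorem sum_mul_emaWeight_sq_le_mul (hα : α ∈ Set.Ioo (0 : ℝ) 1) (hp : 0 ≤ p) (hp1 : p ≤ 1)
    (n : ℕ) : ∑ t ∈ Finset.range n, (p * emaWeight α (1 - p) t) ^ 2 ≤ n * p ^ 2 := by
  refine (Finset.sum_le_card_nsmul _ _ (p ^ 2) fun t _ =>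
    mul_emaWeight_sq_le_rate_sq hα hp hp1 t).trans (le_of_eq ?_)
  simp

theorem emaWeight_mul_sub (n : ℕ) :
    emaWeight α q n * (α - q) = (1 - α) * (α ^ n - q ^ n) := by
  induction n with
  | zero => simp [emaWeight]
  | succ n ih =>
    rw [emaWeight, pow_succ, pow_succ]
    linear_combination q * ih

theorem emaWeight_self (n : ℕ) : emaWeight α α n = n * (1 - α) * α ^ (n - 1) := by
  induction n with
  | zero => simp [emaWeight]
  | succ n ih =>
    rcases n with _ | n
    · simp [emaWeight]
    · rw [emaWeight, ih]
      simp only [Nat.add_sub_cancel]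
      push_cast
      ring

/-- Both branches are the same convolution of the powers of `α` and `1 - δ l`, so the case of equal
rates needs no separate treatment afterwards. -/
theorem decayRate_eq (δ α l : ℝ) (n : ℕ) :
    decayRate δ α n l = α ^ n + emaWeight α (1 - δ * l) n := by
  unfold decayRate
  split_ifs with h
  · rw [h, sub_sub_cancel, emaWeight_self]
  · have h0 : δ * l - (1 - α) ≠ 0 := sub_ne_zero.2 h
    rw [div_eq_iff h0]
    have := emaWeight_mul_sub (α := α) (q := 1 - δ * l) n
    linear_combination -this

end Weight

/-! ### The iterates -/

variable {E : Type*} [NormedAddCommGroup E] [InnerProductSpace ℝ E]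
variable {d : ℕ∞} {b : HilbertBasis (Coord d) ℝ E} {lam : Coord d → ℝ}

/-- The SGD iterates for labels `⟨0, x⟩ + ε`. -/
def centeredIterate {B : ℕ} (ε : E × ℝ → ℝ) (δ : ℝ) (v₀ : E) (s : ℕ × Fin B → E × ℝ) : ℕ → E :=
  sgdIterate δ v₀ fun j => ((s j).1, ε (s j))

section Algebra

variable {B : ℕ} (ε : E × ℝ → ℝ) (δ α : ℝ) (v₀ w₀ w : E) (s : ℕ × Fin B → E × ℝ) (t : ℕ)

theorem centeredIterate_succ : centeredIterate ε δ v₀ s (t + 1) = centeredIterate ε δ v₀ s t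
    + (δ / B) • ∑ i : Fin B, gradientStep ε (centeredIterate ε δ v₀ s t) (s (t + 1, i)) := rfl

theorem sgdIterate_sub : sgdIterate δ w₀ s t - w = centeredIterate (noise w) δ (w₀ - w) s t := by
  induction t with
  | zero => rfl
  | succ t ih =>
    have h : ∀ i : Fin B, gradientStep (noise w) (sgdIterate δ w₀ s t - w) (s (t + 1, i))
        = ((s (t + 1, i)).2 - ⟪sgdIterate δ w₀ s t, (s (t + 1, i)).1⟫) • (s (t + 1, i)).1 := by
      intro i
      rw [gradientStep, noise, inner_sub_left]
      congr 1
      ring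
    rw [centeredIterate_succ, ← ih, sgdIterate, Finset.sum_congr rfl fun i _ => h i]
    abel

/-- Superposition: the iteration is jointly affine in the starting point and the noise. -/
theorem centeredIterate_eq_add : centeredIterate ε δ v₀ s t
    = centeredIterate (fun _ => 0) δ v₀ s t + centeredIterate ε δ 0 s t := by
  induction t with
  | zero => exact (add_zero _).symm
  | succ t ih =>
    rw [centeredIterate_succ, centeredIterate_succ, centeredIterate_succ, ih,
      add_add_add_comm, ← smul_add, ← Finset.sum_add_distrib]
    congr 2
    refine Finset.sum_congr rfl fun i _ => ?_
    simp only [gradientStep, inner_add_left, ← add_smul]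
    congr 1
    ring

theorem inner_centeredIterate_succ (hB : 1 ≤ B) (i : Coord d) :
    ⟪b i, centeredIterate ε δ v₀ s (t + 1)⟫
      = (1 - δ * lam i) * ⟪b i, centeredIterate ε δ v₀ s t⟫
        + δ / B * ∑ j : Fin B, innovation b lam ε i (centeredIterate ε δ v₀ s t) (s (t + 1, j)) := by
  have hB' : (B : ℝ) ≠ 0 := by positivity
  simp only [centeredIterate_succ, inner_add_right, real_inner_smul_right, inner_sum, innovation,
    Finset.sum_add_distrib, Finset.sum_const, Finset.card_univ, Fintype.card_fin, nsmul_eq_mul]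
  field_simp
  ring

theorem emaIterate_zero : emaIterate δ α w₀ s 0 = w₀ := by simp [emaIterate]

theorem emaIterate_succ : emaIterate δ α w₀ s (t + 1)
    = α • emaIterate δ α w₀ s t + (1 - α) • sgdIterate δ w₀ s t := by
  have h : ∀ r ∈ Finset.range t, α ^ (t + 1 - 1 - r) • sgdIterate δ w₀ s r
      = α • (α ^ (t - 1 - r) • sgdIterate δ w₀ s r) := by
    intro r hr
    rw [smul_smul, ← pow_succ']
    congr 2
    have := Finset.mem_range.1 hr
    omega
  rw [emaIterate, emaIterate, Finset.sum_range_succ, Finset.sum_congr rfl h, ← Finset.smul_sum,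
    Nat.add_sub_cancel, Nat.sub_self, pow_zero, one_smul, pow_succ']
  module

theorem emaIterate_sub_succ : emaIterate δ α w₀ s (t + 1) - w
    = α • (emaIterate δ α w₀ s t - w)
      + (1 - α) • centeredIterate (noise w) δ (w₀ - w) s t := by
  rw [emaIterate_succ, ← sgdIterate_sub]
  module

end Algebra

/-! ### Second moments of the iterates -/

variable [MeasurableSpace E] {D : Measure (E × ℝ)}
variable {Ω : Type*} {B : ℕ} {Z : ℕ × Fin B → Ω → E × ℝ} {ε : E × ℝ → ℝ}

/-- The indices of the samples that are observed up to iteration `t`. -/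
def past (B t : ℕ) : Set (ℕ × Fin B) := {j | j.1 ≤ t}

theorem past_mono {r t : ℕ} (h : r ≤ t) : past B r ⊆ past B t := fun _ hj => le_trans hj h

theorem notMem_past (t : ℕ) (i : Fin B) : (t + 1, i) ∉ past B t := by simp [past]

variable [SecondCountableTopology E] [BorelSpace E]

theorem CenteredNoise.measurable_centeredIterate (hε : CenteredNoise D ε) (δ : ℝ) (v₀ : E)
    (t : ℕ) : Measurable[history Z (past B t)]
      fun ω => centeredIterate ε δ v₀ (fun j => Z j ω) t := by
  induction t with
  | zero => exact @measurable_const _ _ _ (history Z (past B 0)) v₀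
  | succ t ih =>
    simp only [centeredIterate_succ]
    have h := ih.mono (history_mono (past_mono t.le_succ)) le_rfl
    refine h.add (Measurable.const_smul (Finset.measurable_sum _ fun i _ => ?_) _)
    exact hε.measurable_gradientStep.comp (h.prodMk (measurable_history (le_refl (t + 1))))

end EMASGD

namespace EMASGD

variable {E : Type*} [NormedAddCommGroup E] [InnerProductSpace ℝ E] [MeasurableSpace E]
  {d : ℕ∞} {D : Measure (E × ℝ)} {b : HilbertBasis (Coord d) ℝ E} {lam : Coord d → ℝ}
  {Ω : Type*} [MeasurableSpace Ω] {P : Measure Ω}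
  {B : ℕ} {Z : ℕ × Fin B → Ω → E × ℝ} {ε : E × ℝ → ℝ} {ψ σ δ α : ℝ} {v₀ w₀ w : E}

/-- Independent mini-batches from a distribution that satisfies the moment conditions. -/
structure SamplingModel (D : Measure (E × ℝ)) (b : HilbertBasis (Coord d) ℝ E)
    (lam : Coord d → ℝ) (ψ : ℝ) (P : Measure Ω) (Z : ℕ × Fin B → Ω → E × ℝ) : Prop where
  second : SecondMomentCondition D b lam
  fourth : FourthMomentCondition D b ψ
  measurable : ∀ j, Measurable (Z j)
  law : ∀ j, P.map (Z j) = D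
  indep : iIndepFun Z P
  one_le : 1 ≤ B

namespace SamplingModel

theorem indepFun (h : SamplingModel D b lam ψ P Z) {t : ℕ} (j : Fin B) {T : Type*}
    [MeasurableSpace T] {Y : Ω → T} (hY : Measurable[history Z (past B t)] Y) :
    IndepFun Y (Z (t + 1, j)) P :=
  indepFun_of_measurable_history h.measurable h.indep (notMem_past t j) hY

variable [SecondCountableTopology E] [BorelSpace E]

theorem measurable_iterate (h : SamplingModel D b lam ψ P Z) (hε : CenteredNoise D ε) (t : ℕ) :
    Measurable fun ω => centeredIterate ε δ v₀ (fun j => Z j ω) t :=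
  (hε.measurable_centeredIterate δ v₀ t).mono (history_le h.measurable _) le_rfl

theorem indepFun_iterate (h : SamplingModel D b lam ψ P Z) (hε : CenteredNoise D ε) (t : ℕ)
    (j : Fin B) :
    IndepFun (fun ω => centeredIterate ε δ v₀ (fun j => Z j ω) t) (Z (t + 1, j)) P :=
  h.indepFun j (hε.measurable_centeredIterate δ v₀ t)

/-- Sum and integral may be exchanged because the terms are dominated by `λ_i` times the second
moment of the norm, and the trace is finite. -/
theorem hasSum_integral_inner_sq [CompleteSpace E] (h : SamplingModel D b lam ψ P Z) {v : Ω → E}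
    (hvm : Measurable v) (hv : MemLp v 2 P) :
    HasSum (fun i => lam i * ∫ ω, ⟪b i, v ω⟫ ^ 2 ∂P) (∫ ω, ⟪v ω, covOp D (v ω)⟫ ∂P) := by
  have hi : ∀ i, Integrable (fun ω => ⟪b i, v ω⟫ ^ 2) P := fun i =>
    (MemLp.const_inner (𝕜 := ℝ) (b i) hv).integrable_sq
  have hn := (memLp_two_iff_integrable_sq_norm (by fun_prop)).1 hv
  have hle : ∀ i, ∫ ω, ⟪b i, v ω⟫ ^ 2 ∂P ≤ ∫ ω, ‖v ω‖ ^ 2 ∂P := by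
    refine fun i => integral_mono (hi i) hn fun ω => ?_
    have := abs_real_inner_le_norm (b i) (v ω)
    rw [b.orthonormal.1 i, one_mul] at this
    exact sq_le_sq.2 (by rwa [abs_norm])
  have hs := hasSum_integral_of_summable_integral_norm
    (F := fun i ω => lam i * ⟪b i, v ω⟫ ^ 2) (fun i => (hi i).const_mul _) (by
      refine Summable.of_nonneg_of_le (fun i => integral_nonneg fun ω => norm_nonneg _)
        (fun i => ?_) (h.second.summable.mul_right (∫ ω, ‖v ω‖ ^ 2 ∂P))
      have : ∀ ω, ‖lam i * ⟪b i, v ω⟫ ^ 2‖ = lam i * ⟪b i, v ω⟫ ^ 2 := fun ω =>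
        Real.norm_of_nonneg (mul_nonneg (h.second.lam_pos i).le (sq_nonneg _))
      simp only [this, integral_const_mul]
      exact mul_le_mul_of_nonneg_left (hle i) (h.second.lam_pos i).le)
  simpa only [integral_const_mul, (h.second.hasSum_inner_covOp _).tsum_eq] using hs

variable [IsProbabilityMeasure P]

theorem memLp_iterate (h : SamplingModel D b lam ψ P Z) (hε : CenteredNoise D ε) (t : ℕ) :
    MemLp (fun ω => centeredIterate ε δ v₀ (fun j => Z j ω) t) 2 P := by
  induction t with
  | zero => exact memLp_const v₀
  | succ t ih =>
    simp only [centeredIterate_succ]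
    have hg : ∀ j : Fin B, MemLp (fun ω => gradientStep ε
        (centeredIterate ε δ v₀ (fun j => Z j ω) t) (Z (t + 1, j) ω)) 2 P := fun j =>
      hε.memLp_gradientStep h.fourth.integrable (h.measurable _) (h.law _)
        (h.measurable_iterate hε t) ih (h.indepFun_iterate hε t j)
    have hsum : MemLp (fun ω => ∑ j : Fin B, gradientStep ε
        (centeredIterate ε δ v₀ (fun j => Z j ω) t) (Z (t + 1, j) ω)) 2 P :=
      memLp_finsetSum _ fun j _ => hg j
    exact ih.add (hsum.const_smul (δ / B : ℝ))

variable [CompleteSpace E] [IsProbabilityMeasure D]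

theorem step (h : SamplingModel D b lam ψ P Z) (hε : CenteredNoise D ε) {t : ℕ}
    {U : Ω → ℝ} {v : Ω → E} (hUm : Measurable[history Z (past B t)] U) (hU : MemLp U 2 P)
    (hvm : Measurable[history Z (past B t)] v) (hv : MemLp v 2 P) (i : Coord d) (a : ℝ) {V : ℝ}
    (hV : ∀ j, ∫ ω, ⟪b i, gradientStep ε (v ω) (Z (t + 1, j) ω)⟫ ^ 2 ∂P ≤ V) :
    ∫ ω, U ω + a * ∑ j, innovation b lam ε i (v ω) (Z (t + 1, j) ω) ∂P = ∫ ω, U ω ∂P ∧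
    ∫ ω, (U ω + a * ∑ j, innovation b lam ε i (v ω) (Z (t + 1, j) ω)) ^ 2 ∂P
      ≤ ∫ ω, U ω ^ 2 ∂P + a ^ 2 * (B * V) := by
  have hinj : Function.Injective fun j : Fin B => (t + 1, j) := Prod.mk_right_injective _
  have := (hε.batch h.second h.fourth.integrable h.measurable h.law h.indep hUm hU hvm hv i a V
    (Finset.univ.map ⟨_, hinj⟩) (by simpa using notMem_past t) (by simpa using hV)).2
  simpa using this

theorem integral_inner_iterate_succ_sq_le (h : SamplingModel D b lam ψ P Z)
    (hε : CenteredNoise D ε) (t : ℕ) (i : Coord d) {V : ℝ}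
    (hV : ∀ j, ∫ ω, ⟪b i, gradientStep ε (centeredIterate ε δ v₀ (fun j => Z j ω) t)
      (Z (t + 1, j) ω)⟫ ^ 2 ∂P ≤ V) :
    ∫ ω, ⟪b i, centeredIterate ε δ v₀ (fun j => Z j ω) (t + 1)⟫ ^ 2 ∂P
      ≤ (1 - δ * lam i) ^ 2 * ∫ ω, ⟪b i, centeredIterate ε δ v₀ (fun j => Z j ω) t⟫ ^ 2 ∂P
        + δ ^ 2 / B * V := by
  have hB : (B : ℝ) ≠ 0 := by have := h.one_le; positivity
  have hm := hε.measurable_centeredIterate (Z := Z) δ v₀ t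
  have hg : Measurable fun u : E => (1 - δ * lam i) * ⟪b i, u⟫ := by fun_prop
  have hv := h.memLp_iterate (δ := δ) (v₀ := v₀) hε t
  have := (h.step hε (hg.comp hm) ((hv.const_inner (b i)).const_mul _) hm hv i (δ / B) hV).2
  simp only [inner_centeredIterate_succ (lam := lam) ε δ v₀ _ t h.one_le i]
  refine this.trans (le_of_eq ?_)
  simp only [Function.comp_apply, mul_pow, integral_const_mul]
  field_simp

theorem integral_iterate_eq_zero (h : SamplingModel D b lam ψ P Z) (hε : CenteredNoise D ε)
    (t : ℕ) : ∫ ω, centeredIterate ε δ 0 (fun j => Z j ω) t ∂P = 0 := by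
  have hi : ∀ t, Integrable (fun ω => centeredIterate ε δ 0 (fun j => Z j ω) t) P :=
    fun t => (h.memLp_iterate hε t).integrable one_le_two
  induction t with
  | zero => simp [centeredIterate, sgdIterate]
  | succ t ih =>
    refine b.repr.injective (lp.ext (funext fun i => ?_))
    have hm := hε.measurable_centeredIterate (Z := Z) δ 0 t
    have hg : Measurable fun u : E => (1 - δ * lam i) * ⟪b i, u⟫ := by fun_prop
    have hv := h.memLp_iterate (δ := δ) (v₀ := 0) hε t
    -- Only the statement about the mean is used, so any bound `V` will do.
    have h1 := (h.step hε (hg.comp hm) ((hv.const_inner (b i)).const_mul _) hm hv i (δ / B)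
      (V := ∑ j, ∫ ω, ⟪b i, gradientStep ε (centeredIterate ε δ 0 (fun j => Z j ω) t)
      (Z (t + 1, j) ω)⟫ ^ 2 ∂P) (fun j => Finset.single_le_sum
        (f := fun j => ∫ ω, ⟪b i, gradientStep ε (centeredIterate ε δ 0 (fun j => Z j ω) t)
          (Z (t + 1, j) ω)⟫ ^ 2 ∂P)
        (fun _ _ => integral_nonneg fun _ => sq_nonneg _) (Finset.mem_univ j))).1
    rw [b.repr_apply_apply, ← integral_inner (hi (t + 1))]
    simp only [inner_centeredIterate_succ (lam := lam) ε δ 0 _ t h.one_le i]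
    refine h1.trans ?_
    simp only [Function.comp_apply, integral_const_mul]
    rw [integral_inner (hi t), ih]
    simp

/-! ### Noise-free and noise-driven parts -/

theorem noiseless_recursion (h : SamplingModel D b lam ψ P Z) (t : ℕ) (i : Coord d) :
    ∫ ω, ⟪b i, centeredIterate (fun _ => 0) δ v₀ (fun j => Z j ω) (t + 1)⟫ ^ 2 ∂P
      ≤ (1 - δ * lam i) ^ 2
          * ∫ ω, ⟪b i, centeredIterate (fun _ => 0) δ v₀ (fun j => Z j ω) t⟫ ^ 2 ∂P
        + δ ^ 2 / B * (lam i * (ψ * ∫ ω, ⟪centeredIterate (fun _ => 0) δ v₀ (fun j => Z j ω) t,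
          covOp D (centeredIterate (fun _ => 0) δ v₀ (fun j => Z j ω) t)⟫ ∂P)) :=
  h.integral_inner_iterate_succ_sq_le centeredNoise_zero t i fun j =>
    integral_inner_gradientStep_zero_sq_le h.second h.fourth (h.measurable _) (h.law _)
      (h.measurable_iterate centeredNoise_zero t) (h.memLp_iterate centeredNoise_zero t)
      (h.indepFun_iterate centeredNoise_zero t j) i

theorem centered_recursion (h : SamplingModel D b lam ψ P Z) (hε : CenteredNoise D ε)
    (hσ : ∀ i, ∫ z, (ε z * ⟪b i, z.1⟫) ^ 2 ∂D ≤ σ ^ 2 * lam i) (t : ℕ) (i : Coord d) :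
    ∫ ω, ⟪b i, centeredIterate ε δ 0 (fun j => Z j ω) (t + 1)⟫ ^ 2 ∂P
      ≤ (1 - δ * lam i) ^ 2 * ∫ ω, ⟪b i, centeredIterate ε δ 0 (fun j => Z j ω) t⟫ ^ 2 ∂P
        + δ ^ 2 / B * (lam i * (σ ^ 2 + ψ * ∫ ω, ⟪centeredIterate ε δ 0 (fun j => Z j ω) t,
          covOp D (centeredIterate ε δ 0 (fun j => Z j ω) t)⟫ ∂P)) :=
  h.integral_inner_iterate_succ_sq_le hε t i fun j =>
    hε.integral_inner_gradientStep_sq_le h.second h.fourth hσ (h.measurable _) (h.law _)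
      (h.measurable_iterate hε t) (h.memLp_iterate hε t) (h.integral_iterate_eq_zero hε t)
      (h.indepFun_iterate hε t j) i

/-- In a stable regime, the noise-driven iterates at most double the gradient noise. -/
theorem noise_risk_le (h : SamplingModel D b lam ψ P Z) (hε : CenteredNoise D ε)
    (hσ : ∀ i, ∫ z, (ε z * ⟪b i, z.1⟫) ^ 2 ∂D ≤ σ ^ 2 * lam i) (hψ : 0 < ψ) (hδ : 0 < δ)
    (hδl : ∀ i, δ * lam i ≤ 1) (hδt : 2 * (δ * ψ * ∑' i, lam i) ≤ B) (t : ℕ) :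
    ψ * ∫ ω, ⟪centeredIterate ε δ 0 (fun j => Z j ω) t,
      covOp D (centeredIterate ε δ 0 (fun j => Z j ω) t)⟫ ∂P ≤ σ ^ 2 := by
  have hB : (0 : ℝ) < B := by have := h.one_le; positivity
  have hK : 0 ≤ 2 * δ * σ ^ 2 / B := by positivity
  -- The invariant is a second moment of at most `K = 2 δ σ² / B` in each coordinate. Weighted by
  -- `λ_i` and summed it gives the claim through `hδt`. The claim in turn bounds the injected
  -- variance by `p K` with `p = δ λ_i`, and `(1 - p)² + p ≤ 1` closes the induction.
  have key : ∀ t, (∀ i, ∫ ω, ⟪b i, centeredIterate ε δ 0 (fun j => Z j ω) t⟫ ^ 2 ∂P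
      ≤ 2 * δ * σ ^ 2 / B) → ψ * ∫ ω, ⟪centeredIterate ε δ 0 (fun j => Z j ω) t,
      covOp D (centeredIterate ε δ 0 (fun j => Z j ω) t)⟫ ∂P ≤ σ ^ 2 := by
    intro t ht
    have h1 := hasSum_le (fun i => mul_le_mul_of_nonneg_left (ht i) (h.second.lam_pos i).le)
      (h.hasSum_integral_inner_sq (h.measurable_iterate hε t) (h.memLp_iterate hε t))
      (h.second.summable.hasSum.mul_right _)
    calc _ ≤ ψ * ((∑' i, lam i) * (2 * δ * σ ^ 2 / B)) := by gcongr
      _ = (2 * (δ * ψ * ∑' i, lam i)) * σ ^ 2 / B := by ring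
      _ ≤ B * σ ^ 2 / B := by gcongr
      _ = σ ^ 2 := by field_simp
  refine key t ?_
  induction t with
  | zero => intro i; simpa [centeredIterate, sgdIterate] using hK
  | succ t ih =>
    intro i
    have hl := h.second.lam_pos i
    have hp : 0 ≤ δ * lam i := by positivity
    calc _ ≤ _ := h.centered_recursion hε hσ t i
      _ ≤ (1 - δ * lam i) ^ 2 * (2 * δ * σ ^ 2 / B)
          + δ ^ 2 / B * (lam i * (σ ^ 2 + σ ^ 2)) := by
        gcongr
        · exact ih i
        · exact key t ih
      _ = (1 - δ * lam i + (δ * lam i) ^ 2) * (2 * δ * σ ^ 2 / B) := by ring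
      _ ≤ 1 * (2 * δ * σ ^ 2 / B) := by
        gcongr
        nlinarith [hδl i]
      _ = _ := one_mul _

end SamplingModel

end EMASGD

namespace EMASGD

/-! ### Sums over the head and the tail of the spectrum -/

theorem hasSum_ite_zero {ι : Type*} (p : ι → Prop) [DecidablePred p] (f : ι → ℝ)
    (hf : Summable fun i : {i // p i} => f i) :
    HasSum (fun i => if p i then f i else 0) (∑' i : {i // p i}, f i) := by
  refine ((hasSum_subtype_iff_indicator (s := {i | p i})).1 hf.hasSum).congr_fun fun i => ?_
  by_cases hi : p i <;> simp [hi]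

theorem Summable.hasSum_ite_zero {ι : Type*} {f : ι → ℝ} (hf : Summable f) (p : ι → Prop)
    [DecidablePred p] : HasSum (fun i => if p i then f i else 0) (∑' i : {i // p i}, f i) :=
  EMASGD.hasSum_ite_zero p f (hf.subtype {i | p i})

variable {E : Type*} [NormedAddCommGroup E] [InnerProductSpace ℝ E] {d : ℕ∞}

theorem summable_inner_sq (b : HilbertBasis (Coord d) ℝ E) (v : E) :
    Summable fun i => ⟪b i, v⟫ ^ 2 := by
  refine (b.summable_inner_mul_inner v v).congr fun i => ?_
  rw [real_inner_comm, sq]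

variable [MeasurableSpace E] {D : Measure (E × ℝ)} {b : HilbertBasis (Coord d) ℝ E} {lam : Coord d → ℝ}
  {Ω : Type*} {B : ℕ} {Z : ℕ × Fin B → Ω → E × ℝ} {ε : E × ℝ → ℝ} {ψ σ δ α : ℝ} {v₀ w₀ w : E}

theorem finite_coord_le (k : ℕ) : Finite {i : Coord d // (i : ℕ) ≤ k} :=
  Finite.of_injective (β := Fin (k + 1)) (fun i => ⟨i.1.1, Nat.lt_succ_of_le i.2⟩)
    fun _ _ h => Subtype.ext (Subtype.ext (Fin.mk.inj h))

theorem tsum_const_coord_le {c : ℝ} (hc : 0 ≤ c) (k : ℕ) :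
    ∑' _ : {i : Coord d // (i : ℕ) ≤ k}, c ≤ k * c := by
  have h : Nat.card {i : Coord d // (i : ℕ) ≤ k} ≤ k := by
    -- Coordinates start at `1`, hence the shift; there may be fewer than `k` of them if `d < k`.
    refine (Nat.card_le_card_of_injective (β := Fin k)
      (fun i => ⟨i.1.1 - 1, by have := i.1.2.1; have := i.2; omega⟩) fun i j h => ?_).trans
      (by simp)
    have h1 := Fin.mk.inj h
    have h2 := i.1.2.1
    have h3 := j.1.2.1
    exact Subtype.ext (Subtype.ext (by omega))
  rw [tsum_const, nsmul_eq_mul]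
  gcongr

theorem SecondMomentCondition.summable_sq (h : SecondMomentCondition D b lam) :
    Summable fun i => lam i ^ 2 := by
  refine (h.summable.mul_left ‖covOp D‖).of_nonneg_of_le (fun i => sq_nonneg _) fun i => ?_
  rw [sq]
  exact mul_le_mul_of_nonneg_right (h.lam_le_norm i) (h.lam_pos i).le

namespace SamplingModel

variable [SecondCountableTopology E] [BorelSpace E]
/-! ### The averaged iterate -/

theorem measurable_emaIterate_sub (hε : CenteredNoise D (noise w)) (t : ℕ) :
    Measurable[history Z (past B t)] fun ω => emaIterate δ α w₀ (fun j => Z j ω) t - w := by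
  induction t with
  | zero =>
    simp only [emaIterate_zero]
    exact @measurable_const _ _ _ (history Z (past B 0)) (w₀ - w)
  | succ t ih =>
    simp only [emaIterate_sub_succ]
    have hle : history Z (past B t) ≤ history Z (past B (t + 1)) :=
      history_mono (past_mono t.le_succ)
    exact ((ih.mono hle le_rfl).const_smul α).add
      (((hε.measurable_centeredIterate δ (w₀ - w) t).mono hle le_rfl).const_smul (1 - α))

variable [MeasurableSpace Ω] {P : Measure Ω} [IsProbabilityMeasure P]

theorem memLp_emaIterate_sub (h : SamplingModel D b lam ψ P Z) (hε : CenteredNoise D (noise w))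
    (t : ℕ) : MemLp (fun ω => emaIterate δ α w₀ (fun j => Z j ω) t - w) 2 P := by
  induction t with
  | zero =>
    simp only [emaIterate_zero]
    exact memLp_const (w₀ - w)
  | succ t ih =>
    simp only [emaIterate_sub_succ]
    have hv := h.memLp_iterate (δ := δ) (v₀ := w₀ - w) hε t
    exact (ih.const_smul α).add (hv.const_smul (1 - α))

variable [CompleteSpace E] [IsProbabilityMeasure D]

/-- The accumulated risk of the noise-free iterates. -/
theorem sum_noiseless_risk_le (h : SamplingModel D b lam ψ P Z) (hψ : 0 < ψ) (hδ : 0 < δ)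
    (hδl : ∀ i, δ * lam i ≤ 1) (hδt : 2 * (δ * ψ * ∑' i, lam i) ≤ B) (k n : ℕ) :
    δ * ∑ t ∈ Finset.range n, ∫ ω, ⟪centeredIterate (fun _ => 0) δ v₀ (fun j => Z j ω) t,
        covOp D (centeredIterate (fun _ => 0) δ v₀ (fun j => Z j ω) t)⟫ ∂P
      ≤ 2 * (headNormSq b k v₀ + n * δ * tailNormSq b lam k v₀) := by
  have hB : (0 : ℝ) < B := by have := h.one_le; positivity
  set A : ℕ → ℝ := fun t => ∫ ω, ⟪centeredIterate (fun _ => 0) δ v₀ (fun j => Z j ω) t,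
    covOp D (centeredIterate (fun _ => 0) δ v₀ (fun j => Z j ω) t)⟫ ∂P
  set e : Coord d → ℕ → ℝ := fun i t =>
    ∫ ω, ⟪b i, centeredIterate (fun _ => 0) δ v₀ (fun j => Z j ω) t⟫ ^ 2 ∂P with he
  have hA0 : ∀ t, 0 ≤ A t := fun t => integral_nonneg fun ω => h.second.inner_covOp_nonneg _
  have he0 : ∀ i t, 0 ≤ e i t := fun i t => integral_nonneg fun ω => sq_nonneg _
  have hinit : ∀ i, e i 0 = ⟪b i, v₀⟫ ^ 2 := by
    intro i
    simp [he, centeredIterate, sgdIterate]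
  have hrec : ∀ i t, e i (t + 1) ≤ (1 - δ * lam i) * e i t + δ ^ 2 / B * (lam i * (ψ * A t)) := by
    intro i t
    have hl := h.second.lam_pos i
    have hp : 0 ≤ δ * lam i := by positivity
    refine (h.noiseless_recursion t i).trans ?_
    refine add_le_add_left (mul_le_mul_of_nonneg_right ?_ (he0 i t)) _
    nlinarith [hδl i]
  have hr0 : ∀ i t, 0 ≤ δ ^ 2 / B * (lam i * (ψ * A t)) := fun i t => by
    have := hA0 t
    have := h.second.lam_pos i
    positivity
  have hrsum : ∀ i, ∑ t ∈ Finset.range n, δ ^ 2 / B * (lam i * (ψ * A t))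
      = lam i * (δ ^ 2 / B * ψ * ∑ t ∈ Finset.range n, A t) := by
    intro i
    simp only [Finset.mul_sum]
    exact Finset.sum_congr rfl fun t _ => by ring
  have hsum : HasSum (fun i => δ * ∑ t ∈ Finset.range n, lam i * e i t)
      (δ * ∑ t ∈ Finset.range n, A t) :=
    (hasSum_sum fun t _ => h.hasSum_integral_inner_sq (h.measurable_iterate centeredNoise_zero t)
      (h.memLp_iterate centeredNoise_zero t)).mul_left δ
  have hhead := Summable.hasSum_ite_zero (summable_inner_sq b v₀) fun i => (i : ℕ) ≤ k
  have htail := Summable.hasSum_ite_zero (h.second.hasSum_inner_covOp v₀).summable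
    fun i => k < (i : ℕ)
  have hm := (hhead.add (htail.mul_left (n * δ))).add
    (h.second.summable.hasSum.mul_right (δ ^ 2 / B * ψ * ∑ t ∈ Finset.range n, A t))
  have hle := hasSum_le (fun i => ?_) hsum hm
  -- The self-induced fluctuations cost at most half of the left side, so they are absorbed there;
  -- this is the source of the factor `2` in the conclusion.
  · have h1 : (∑' i, lam i) * (δ ^ 2 / B * ψ * ∑ t ∈ Finset.range n, A t)
        ≤ δ * (∑ t ∈ Finset.range n, A t) / 2 := by
      have hS : 0 ≤ ∑ t ∈ Finset.range n, A t := Finset.sum_nonneg fun t _ => hA0 t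
      calc _ = (2 * (δ * ψ * ∑' i, lam i)) * (δ * ∑ t ∈ Finset.range n, A t) / (2 * B) := by
            field_simp
        _ ≤ B * (δ * ∑ t ∈ Finset.range n, A t) / (2 * B) := by gcongr
        _ = _ := by field_simp
    unfold headNormSq tailNormSq
    linarith
  · have hp : 0 ≤ δ * lam i := mul_nonneg hδ.le (h.second.lam_pos i).le
    rw [← Finset.mul_sum, ← mul_assoc, ← hrsum, ← hinit]
    -- A head coordinate pays its full initial value, whatever the horizon; a tail coordinate pays
    -- only `n δ λ_i` times it.
    rcases le_or_gt (i : ℕ) k with hik | hik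
    · rw [if_pos hik, if_neg hik.not_gt, mul_zero, add_zero]
      exact mul_sum_le_of_le_recursion (he0 i) (hrec i) n
    · rw [if_neg hik.not_ge, if_pos hik, zero_add, ← mul_assoc, mul_assoc (n : ℝ)]
      exact mul_sum_le_of_le_recursion_short hp (hδl i) (he0 i 0) (hr0 i) (hrec i) n

/-! ### The excess risk -/

/-- The vector on the left has as `i`-th coordinate the conditional mean, given the first `s` steps,
of that coordinate of the averaged error at time `n + s`. Passing from `s` to `s + 1` with `n + s`
fixed adds one orthogonal batch of innovations. -/
theorem integral_ema_sq_le (h : SamplingModel D b lam ψ P Z) (hε : CenteredNoise D (noise w))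
    (i : Coord d) {V : ℕ → ℝ}
    (hV : ∀ t j, ∫ ω, ⟪b i, gradientStep (noise w)
      (centeredIterate (noise w) δ (w₀ - w) (fun j => Z j ω) t) (Z (t + 1, j) ω)⟫ ^ 2 ∂P ≤ V t)
    (s n : ℕ) :
    ∫ ω, ⟪b i, α ^ n • (emaIterate δ α w₀ (fun j => Z j ω) s - w)
        + emaWeight α (1 - δ * lam i) n
          • centeredIterate (noise w) δ (w₀ - w) (fun j => Z j ω) s⟫ ^ 2 ∂P
      ≤ ((α ^ (n + s) + emaWeight α (1 - δ * lam i) (n + s)) * ⟪b i, w₀ - w⟫) ^ 2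
        + ∑ r ∈ Finset.range s,
          (δ / B * emaWeight α (1 - δ * lam i) (n + (s - 1 - r))) ^ 2 * (B * V r) := by
  induction s generalizing n with
  | zero =>
    simp only [emaIterate_zero, centeredIterate, sgdIterate, ← add_smul, real_inner_smul_right]
    simp
  | succ s ih =>
    -- The recursion of `emaWeight` is exactly what makes the drift parts agree.
    have heq : ∀ ω, ⟪b i, α ^ n • (emaIterate δ α w₀ (fun j => Z j ω) (s + 1) - w)
        + emaWeight α (1 - δ * lam i) n
          • centeredIterate (noise w) δ (w₀ - w) (fun j => Z j ω) (s + 1)⟫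
        = ⟪b i, α ^ (n + 1) • (emaIterate δ α w₀ (fun j => Z j ω) s - w)
        + emaWeight α (1 - δ * lam i) (n + 1)
          • centeredIterate (noise w) δ (w₀ - w) (fun j => Z j ω) s⟫
        + δ / B * emaWeight α (1 - δ * lam i) n * ∑ j : Fin B, innovation b lam (noise w) i
          (centeredIterate (noise w) δ (w₀ - w) (fun j => Z j ω) s) (Z (s + 1, j) ω) := by
      intro ω
      rw [emaIterate_sub_succ]
      simp only [inner_add_right, real_inner_smul_right,
        inner_centeredIterate_succ (lam := lam) (noise w) δ (w₀ - w) _ s h.one_le i, emaWeight]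
      ring
    simp only [heq]
    have hm := hε.measurable_centeredIterate (Z := Z) δ (w₀ - w) s
    have hv := h.memLp_iterate (δ := δ) (v₀ := w₀ - w) hε s
    have hUm := ((measurable_emaIterate_sub (Z := Z) (δ := δ) (α := α) (w₀ := w₀) hε s).const_smul
      (α ^ (n + 1))).add (hm.const_smul (emaWeight α (1 - δ * lam i) (n + 1)))
    have hU := ((h.memLp_emaIterate_sub (δ := δ) (α := α) (w₀ := w₀) hε s).const_smul
      (α ^ (n + 1))).add (hv.const_smul (emaWeight α (1 - δ * lam i) (n + 1)))
    have hg : Measurable fun u : E => ⟪b i, u⟫ := by fun_prop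
    have hstep := (h.step hε (hg.comp hUm) (hU.const_inner (b i)) hm hv i
      (δ / B * emaWeight α (1 - δ * lam i) n) (hV s)).2
    refine hstep.trans ((add_le_add_left (ih (n + 1)) _).trans (le_of_eq ?_))
    have hsum : ∀ r ∈ Finset.range s,
        (δ / B * emaWeight α (1 - δ * lam i) (n + 1 + (s - 1 - r))) ^ 2 * (B * V r)
        = (δ / B * emaWeight α (1 - δ * lam i) (n + (s + 1 - 1 - r))) ^ 2 * (B * V r) := by
      intro r hr
      have hr' := Finset.mem_range.1 hr
      rw [show n + 1 + (s - 1 - r) = n + (s + 1 - 1 - r) by omega]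
    rw [Finset.sum_range_succ, Finset.sum_congr rfl hsum, Nat.add_sub_cancel, Nat.sub_self,
      show n + 1 + s = n + (s + 1) by ring, add_zero, add_assoc]

/-- The gradient splits along the noise-free and the noise-driven iterate, at the cost of a factor
`2`. The second part carries at most `2 σ²`: `σ²` from the labels and `σ²` from `noise_risk_le`. -/
theorem integral_inner_gradientStep_sq_le (h : SamplingModel D b lam ψ P Z)
    (hε : CenteredNoise D ε) (hσ : ∀ i, ∫ z, (ε z * ⟪b i, z.1⟫) ^ 2 ∂D ≤ σ ^ 2 * lam i)
    (hψ : 0 < ψ) (hδ : 0 < δ) (hδl : ∀ i, δ * lam i ≤ 1)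
    (hδt : 2 * (δ * ψ * ∑' i, lam i) ≤ B) (i : Coord d) (t : ℕ) (j : Fin B) :
    ∫ ω, ⟪b i, gradientStep ε (centeredIterate ε δ v₀ (fun j => Z j ω) t)
        (Z (t + 1, j) ω)⟫ ^ 2 ∂P
      ≤ lam i * (2 * (ψ * ∫ ω, ⟪centeredIterate (fun _ => 0) δ v₀ (fun j => Z j ω) t,
        covOp D (centeredIterate (fun _ => 0) δ v₀ (fun j => Z j ω) t)⟫ ∂P) + 4 * σ ^ 2) := by
  have h0 : CenteredNoise D (fun _ : E × ℝ => 0) := centeredNoise_zero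
  have hβ := integral_inner_gradientStep_zero_sq_le h.second h.fourth (h.measurable _) (h.law _)
    (h.measurable_iterate h0 t) (h.memLp_iterate (δ := δ) (v₀ := v₀) h0 t)
    (h.indepFun_iterate h0 t j) i
  have hη := hε.integral_inner_gradientStep_sq_le h.second h.fourth hσ (h.measurable _) (h.law _)
    (h.measurable_iterate hε t) (h.memLp_iterate hε t) (h.integral_iterate_eq_zero (δ := δ) hε t)
    (h.indepFun_iterate hε t j) i
  have hβi : MemLp (fun ω => ⟪b i, gradientStep (fun _ => 0)
      (centeredIterate (fun _ => 0) δ v₀ (fun j => Z j ω) t) (Z (t + 1, j) ω)⟫) 2 P :=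
    MemLp.const_inner (b i) (h0.memLp_gradientStep h.fourth.integrable (h.measurable _) (h.law _)
      (h.measurable_iterate h0 t) (h.memLp_iterate h0 t) (h.indepFun_iterate h0 t j))
  have hηi : MemLp (fun ω => ⟪b i, gradientStep ε
      (centeredIterate ε δ 0 (fun j => Z j ω) t) (Z (t + 1, j) ω)⟫) 2 P :=
    MemLp.const_inner (b i) (hε.memLp_gradientStep h.fourth.integrable (h.measurable _) (h.law _)
      (h.measurable_iterate hε t) (h.memLp_iterate hε t) (h.indepFun_iterate hε t j))
  have hle := integral_mono_of_nonneg (μ := P) (.of_forall fun ω => sq_nonneg _)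
    ((hβi.integrable_sq.const_mul 2).add (hηi.integrable_sq.const_mul 2))
    (f := fun ω => ⟪b i, gradientStep ε (centeredIterate ε δ v₀ (fun j => Z j ω) t)
        (Z (t + 1, j) ω)⟫ ^ 2) (.of_forall fun ω => by
      have heq : ⟪b i, gradientStep ε (centeredIterate ε δ v₀ (fun j => Z j ω) t)
          (Z (t + 1, j) ω)⟫
          = ⟪b i, gradientStep (fun _ => 0)
            (centeredIterate (fun _ => 0) δ v₀ (fun j => Z j ω) t) (Z (t + 1, j) ω)⟫
            + ⟪b i, gradientStep ε
              (centeredIterate ε δ 0 (fun j => Z j ω) t) (Z (t + 1, j) ω)⟫ := by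
        rw [centeredIterate_eq_add, ← inner_add_right, gradientStep, gradientStep, gradientStep,
          inner_add_left, ← add_smul]
        congr 2
        ring
      simp only [heq, Pi.add_apply]
      linarith [add_sq_le (a := ⟪b i, gradientStep (fun _ => 0)
            (centeredIterate (fun _ => 0) δ v₀ (fun j => Z j ω) t) (Z (t + 1, j) ω)⟫)
            (b := ⟪b i, gradientStep ε
              (centeredIterate ε δ 0 (fun j => Z j ω) t) (Z (t + 1, j) ω)⟫)])
  rw [integral_add' (hβi.integrable_sq.const_mul 2) (hηi.integrable_sq.const_mul 2),
    integral_const_mul, integral_const_mul] at hle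
  have hnoise := mul_le_mul_of_nonneg_left (h.noise_risk_le hε hσ hψ hδ hδl hδt t)
    (h.second.lam_pos i).le
  linarith

/-- The excess risk of the average, for arbitrary cutoffs `k` and `l`. -/
theorem half_integral_risk_le (h : SamplingModel D b lam ψ P Z) (hε : CenteredNoise D (noise w))
    (hσ : ∀ i, ∫ z, (noise w z * ⟪b i, z.1⟫) ^ 2 ∂D ≤ σ ^ 2 * lam i)
    (hψ : 0 < ψ) (hδ : 0 < δ) (hδl : ∀ i, δ * lam i ≤ 1)
    (hδt : 2 * (δ * ψ * ∑' i, lam i) ≤ B) (hα : α ∈ Set.Ioo (0 : ℝ) 1) (N k l : ℕ) :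
    1 / 2 * ∫ ω, ⟪emaIterate δ α w₀ (fun j => Z j ω) N - w,
        covOp D (emaIterate δ α w₀ (fun j => Z j ω) N - w)⟫ ∂P
      ≤ effectiveBias b lam δ α N (w₀ - w)
        + ((k * (1 - α) ^ 2 + δ ^ 2 * ∑' i : {i : Coord d // k < (i : ℕ)}, lam i ^ 2)
            * (2 * ψ * (headNormSq b l (w₀ - w) + N * δ * tailNormSq b lam l (w₀ - w)) / (δ * B))
          + 2 * σ ^ 2 / B * ((1 - α) * k
            + δ * ∑' i : {i : Coord d // k < (i : ℕ) ∧ (i : ℕ) ≤ l}, lam i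
            + N * δ ^ 2 * ∑' i : {i : Coord d // l < (i : ℕ)}, lam i ^ 2)) := by
  have hB : (0 : ℝ) < B := by have := h.one_le; positivity
  set A : ℕ → ℝ := fun t => ∫ ω, ⟪centeredIterate (fun _ => 0) δ (w₀ - w) (fun j => Z j ω) t,
    covOp D (centeredIterate (fun _ => 0) δ (w₀ - w) (fun j => Z j ω) t)⟫ ∂P
  have hA0 : ∀ t, 0 ≤ A t := fun t => integral_nonneg fun ω => h.second.inner_covOp_nonneg _
  set S := ∑ t ∈ Finset.range N, A t with hS
  set e : Coord d → ℝ := fun i => ∫ ω, ⟪b i, emaIterate δ α w₀ (fun j => Z j ω) N - w⟫ ^ 2 ∂P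
  have hp : ∀ i, 0 ≤ δ * lam i := fun i => mul_nonneg hδ.le (h.second.lam_pos i).le
  have hα' : 0 ≤ 1 - α := sub_nonneg.2 hα.2.le
  -- the coordinates
  have hcoord : ∀ i, 1 / 2 * (lam i * e i)
      ≤ ⟪b i, w₀ - w⟫ ^ 2 * lam i * decayRate δ α N (lam i) ^ 2
        + (∑ r ∈ Finset.range N, (δ * lam i * emaWeight α (1 - δ * lam i) (N - 1 - r)) ^ 2 * A r)
          * (ψ / B)
        + 2 * σ ^ 2 / B
          * ∑ r ∈ Finset.range N, (δ * lam i * emaWeight α (1 - δ * lam i) r) ^ 2 := by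
    intro i
    have hl := (h.second.lam_pos i).le
    -- At `n = 0` the weight of the last iterate is zero, and the averaged error itself remains.
    have h1 := h.integral_ema_sq_le (α := α) (w₀ := w₀) hε i
      (fun t j => h.integral_inner_gradientStep_sq_le hε hσ hψ hδ hδl hδt i t j) N 0
    simp only [pow_zero, one_smul, emaWeight, zero_smul, add_zero, zero_add, ← decayRate_eq] at h1
    have h2 := mul_le_mul_of_nonneg_left h1 (by positivity : 0 ≤ 1 / 2 * lam i)
    -- Nonnegativity allows the factor `1 / 2` on the bias to be dropped; on the variance it cancels
    -- against the `2` and `4` of the gradient bound.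
    have h3 : 0 ≤ ⟪b i, w₀ - w⟫ ^ 2 * lam i * decayRate δ α N (lam i) ^ 2 := by positivity
    rw [← Finset.sum_range_reflect
      (fun r => (δ * lam i * emaWeight α (1 - δ * lam i) r) ^ 2) N, Finset.sum_mul,
      Finset.mul_sum, add_assoc, ← Finset.sum_add_distrib]
    rw [mul_add, Finset.mul_sum] at h2
    have h4 : ∀ r ∈ Finset.range N, 1 / 2 * lam i
          * ((δ / B * emaWeight α (1 - δ * lam i) (N - 1 - r)) ^ 2
            * (B * (lam i * (2 * (ψ * A r) + 4 * σ ^ 2))))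
        = (δ * lam i * emaWeight α (1 - δ * lam i) (N - 1 - r)) ^ 2 * A r * (ψ / B)
          + 2 * σ ^ 2 / B * (δ * lam i * emaWeight α (1 - δ * lam i) (N - 1 - r)) ^ 2 := by
      intro r _
      field_simp
      ring
    rw [Finset.sum_congr rfl h4] at h2
    linarith
  -- the bounds on the weights
  have hvar : ∀ i,
      ∑ r ∈ Finset.range N, (δ * lam i * emaWeight α (1 - δ * lam i) (N - 1 - r)) ^ 2 * A r
        ≤ ((if (i : ℕ) ≤ k then (1 - α) ^ 2 else 0)
          + δ ^ 2 * (if k < (i : ℕ) then lam i ^ 2 else 0)) * S := by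
    intro i
    rw [hS, Finset.mul_sum]
    refine Finset.sum_le_sum fun r _ => mul_le_mul_of_nonneg_right ?_ (hA0 r)
    rcases le_or_gt (i : ℕ) k with hik | hik
    · rw [if_pos hik, if_neg hik.not_gt, mul_zero, add_zero]
      exact mul_emaWeight_sq_le_sq hα (hp i) (hδl i) _
    · rw [if_neg hik.not_ge, if_pos hik, zero_add, ← mul_pow]
      exact mul_emaWeight_sq_le_rate_sq hα (hp i) (hδl i) _
  have hnoise : ∀ i,
      ∑ r ∈ Finset.range N, (δ * lam i * emaWeight α (1 - δ * lam i) r) ^ 2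
        ≤ (if (i : ℕ) ≤ k then 1 - α else 0)
          + δ * (if k < (i : ℕ) ∧ (i : ℕ) ≤ l then lam i else 0)
          + N * δ ^ 2 * (if l < (i : ℕ) then lam i ^ 2 else 0) := by
    intro i
    have hl := (h.second.lam_pos i).le
    rcases le_or_gt (i : ℕ) k with hik | hik
    · have h1 := sum_mul_emaWeight_sq_le_one_sub hα (hp i) (hδl i) N
      -- If `l < k`, a head coordinate can also occur in the last tail; that term is a nonnegative
      -- surplus.
      have h2 : 0 ≤ N * δ ^ 2 * (if l < (i : ℕ) then lam i ^ 2 else 0) := by positivity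
      rw [if_pos hik, if_neg fun h => hik.not_gt h.1]
      linarith
    · rcases le_or_gt (i : ℕ) l with hil | hil
      · rw [if_neg hik.not_ge, if_pos ⟨hik, hil⟩, if_neg hil.not_gt, mul_zero, add_zero, zero_add]
        exact sum_mul_emaWeight_sq_le_rate hα (hp i) (hδl i) N
      · rw [if_neg hik.not_ge, if_neg fun h => hil.not_ge h.2, if_pos hil, mul_zero, zero_add,
          zero_add, mul_assoc, ← mul_pow]
        exact sum_mul_emaWeight_sq_le_mul hα (hp i) (hδl i) N
  -- the sums over the coordinates
  have := finite_coord_le (d := d) k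
  have hbias : HasSum (fun i => ⟪b i, w₀ - w⟫ ^ 2 * lam i * decayRate δ α N (lam i) ^ 2)
      (effectiveBias b lam δ α N (w₀ - w)) := by
    refine Summable.hasSum ((h.second.hasSum_inner_covOp (w₀ - w)).summable.of_nonneg_of_le
      (fun i => ?_) fun i => ?_)
    · have := (h.second.lam_pos i).le
      positivity
    · have h1 := emaWeight_nonneg hα (sub_nonneg.2 (hδl i)) N
      have h2 := emaWeight_le hα (sub_nonneg.2 (hδl i)) (sub_le_self _ (hp i)) N
      rw [mul_comm (lam i), decayRate_eq]
      refine mul_le_of_le_one_right (mul_nonneg (sq_nonneg _) (h.second.lam_pos i).le)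
        (pow_le_one₀ (add_nonneg (pow_nonneg hα.1.le N) h1) (by linarith))
  have hvarSum := ((hasSum_ite_zero (fun i : Coord d => (i : ℕ) ≤ k) (fun _ => (1 - α) ^ 2)
    Summable.of_finite).add ((Summable.hasSum_ite_zero h.second.summable_sq
      fun i => k < (i : ℕ)).mul_left (δ ^ 2))).mul_right S
  have hnoiseSum := ((hasSum_ite_zero (fun i : Coord d => (i : ℕ) ≤ k) (fun _ => 1 - α)
    Summable.of_finite).add ((Summable.hasSum_ite_zero h.second.summable
      fun i => k < (i : ℕ) ∧ (i : ℕ) ≤ l).mul_left δ)).add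
    ((Summable.hasSum_ite_zero h.second.summable_sq fun i => l < (i : ℕ)).mul_left (N * δ ^ 2))
  have htotal := hasSum_le
    (fun i => (hcoord i).trans (add_le_add (add_le_add le_rfl
      (mul_le_mul_of_nonneg_right (hvar i) (by positivity : 0 ≤ ψ / B)))
      (mul_le_mul_of_nonneg_left (hnoise i) (by positivity : 0 ≤ 2 * σ ^ 2 / B))))
    ((h.hasSum_integral_inner_sq ((measurable_emaIterate_sub hε N).mono
      (history_le h.measurable _) le_rfl) (h.memLp_emaIterate_sub hε N)).mul_left (1 / 2))
    ((hbias.add (hvarSum.mul_right (ψ / B))).add (hnoiseSum.mul_left (2 * σ ^ 2 / B)))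
  refine htotal.trans ?_
  rw [add_assoc]
  refine add_le_add le_rfl (add_le_add ?_ ?_)
  · have h1 := h.sum_noiseless_risk_le (v₀ := w₀ - w) hψ hδ hδl hδt l N
    have h2 : S * (ψ / B) ≤ 2 * ψ * (headNormSq b l (w₀ - w)
        + N * δ * tailNormSq b lam l (w₀ - w)) / (δ * B) := by
      calc S * (ψ / B) = ψ * (δ * S) / (δ * B) := by field_simp
        _ ≤ ψ * (2 * (headNormSq b l (w₀ - w) + N * δ * tailNormSq b lam l (w₀ - w)))
            / (δ * B) := by gcongr
        _ = _ := by ring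
    have hS0 : 0 ≤ S := Finset.sum_nonneg fun t _ => hA0 t
    have h3 : 0 ≤ ∑' i : {i : Coord d // k < (i : ℕ)}, lam i ^ 2 :=
      tsum_nonneg fun i => sq_nonneg _
    rw [mul_assoc]
    refine mul_le_mul (add_le_add (tsum_const_coord_le (sq_nonneg _) k) le_rfl) h2 ?_ ?_ <;>
      positivity
  · refine mul_le_mul_of_nonneg_left (add_le_add (add_le_add ?_ le_rfl) le_rfl) (by positivity)
    exact (tsum_const_coord_le hα' k).trans_eq (mul_comm _ _)

end SamplingModel

end EMASGD

end

/-! ### The main theorem -/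

theorem theorem3 {E : Type*} [NormedAddCommGroup E] [InnerProductSpace ℝ E] [CompleteSpace E]
    [SecondCountableTopology E] [MeasurableSpace E] [BorelSpace E]
    -- the data distribution, the eigenbasis and the eigenvalues of its covariance
    {d : ℕ∞} (D : Measure (E × ℝ)) [IsProbabilityMeasure D]
    (b : HilbertBasis (EMASGD.Coord d) ℝ E) (lam : EMASGD.Coord d → ℝ)
    (wstar w₀ : E) (ψ σ δ α : ℝ) (N B : ℕ)
    -- the risk is finite and minimized by `wstar`
    (hy : Integrable (fun z : E × ℝ => z.2 ^ 2) D)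
    (hmin : EMASGD.IsMinimizer D wstar)
    (hsecond : EMASGD.SecondMomentCondition D b lam)
    (hψ : 0 < ψ) (hfourth : EMASGD.FourthMomentCondition D b ψ)
    (hnoise : EMASGD.WeakNoiseCondition D b lam wstar σ)
    -- the hyperparameters
    (hN : 1 ≤ N) (hB : 1 ≤ B) (hα : α ∈ Set.Ioo (0 : ℝ) 1) (hδ : 0 < δ)
    (hδ' : δ < min (B / (2 * ψ * EMASGD.trace b (EMASGD.covOp D))) (1 / ‖EMASGD.covOp D‖))
    -- independent samples with distribution `D`
    {Ω : Type*} [MeasurableSpace Ω] (P : Measure Ω) [IsProbabilityMeasure P]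
    (Z : ℕ × Fin B → Ω → E × ℝ)
    (hlaw : ∀ j, HasLaw (Z j) D P) (hindep : iIndepFun Z P) :
    Integrable (fun ω => EMASGD.risk D (EMASGD.emaIterate δ α w₀ (fun j => Z j ω) N)) P ∧
    (∫ ω, EMASGD.risk D (EMASGD.emaIterate δ α w₀ (fun j => Z j ω) N) ∂P)
        - EMASGD.risk D wstar
      ≤ EMASGD.effectiveBias b lam δ α N (w₀ - wstar)
        + EMASGD.effectiveVarBound b lam δ α ψ σ N B (w₀ - wstar) := by
  have hB0 : (0 : ℝ) < B := by positivity
  have hl := hsecond.lam_pos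
  obtain ⟨hδ1, hδ2⟩ := lt_min_iff.1 hδ'
  have htr : 0 ≤ EMASGD.trace b (EMASGD.covOp D) := by
    rw [hsecond.trace_covOp]
    exact tsum_nonneg fun i => (hl i).le
  have hδt : 2 * (δ * ψ * ∑' i, lam i) ≤ B := by
    rw [← hsecond.trace_covOp]
    -- A vanishing trace, possible only without coordinates, is split off because the division in
    -- `hδ1` cannot be cleared there.
    rcases htr.eq_or_lt with h0 | h0
    · rw [← h0]
      simp
    · have := (lt_div_iff₀ (by positivity)).1 hδ1
      linarith
  have hδl : ∀ i, δ * lam i ≤ 1 := by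
    intro i
    have h0 : 0 < ‖EMASGD.covOp D‖ := (hl i).trans_le (hsecond.lam_le_norm i)
    have h1 := (lt_div_iff₀ h0).1 hδ2
    exact (mul_le_mul_of_nonneg_left (hsecond.lam_le_norm i) hδ.le).trans h1.le
  have hε : EMASGD.CenteredNoise D (EMASGD.noise wstar) :=
    { measurable := by unfold EMASGD.noise; fun_prop
      integrable := hnoise.integrable_sq_mul
      integral_mul_inner := hmin.integral_noise_mul_inner hy hsecond }
  -- measurable versions of the samples
  set Y : ℕ × Fin B → Ω → E × ℝ := fun j => (hlaw j).aemeasurable.mk (Z j)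
  have hZY : ∀ j, Z j =ᵐ[P] Y j := fun j => (hlaw j).aemeasurable.ae_eq_mk
  have hmodel : EMASGD.SamplingModel D b lam ψ P Y :=
    { second := hsecond
      fourth := hfourth
      measurable := fun j => (hlaw j).aemeasurable.measurable_mk
      law := fun j => by rw [← Measure.map_congr (hZY j), (hlaw j).map_eq]
      indep := hindep.congr hZY
      one_le := hB }
  have hae : (fun ω => EMASGD.risk D (EMASGD.emaIterate δ α w₀ (fun j => Z j ω) N)) =ᵐ[P]
      fun ω => EMASGD.risk D wstar + 1 / 2 * ⟪EMASGD.emaIterate δ α w₀ (fun j => Y j ω) N - wstar,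
        EMASGD.covOp D (EMASGD.emaIterate δ α w₀ (fun j => Y j ω) N - wstar)⟫ := by
    -- There are countably many samples, so a single null set suffices.
    filter_upwards [ae_all_iff.2 hZY] with ω hω
    simp only [hω]
    exact hmin.risk_eq hy hsecond _
  have hint : Integrable (fun ω => ⟪EMASGD.emaIterate δ α w₀ (fun j => Y j ω) N - wstar,
      EMASGD.covOp D (EMASGD.emaIterate δ α w₀ (fun j => Y j ω) N - wstar)⟫) P :=
    EMASGD.integrable_inner_covOp
      ((EMASGD.SamplingModel.measurable_emaIterate_sub hε N).mono
        (EMASGD.history_le hmodel.measurable _) le_rfl) (hmodel.memLp_emaIterate_sub hε N)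
  refine ⟨((integrable_const _).add (hint.const_mul (1 / 2))).congr hae.symm, ?_⟩
  rw [integral_congr_ae hae, integral_add (integrable_const _) (hint.const_mul (1 / 2)), integral_const_mul,
    integral_const, probReal_univ, one_smul, add_sub_cancel_left]
  -- The free cutoffs are unified with `kStar` and `kDagger`.
  exact hmodel.half_integral_risk_le hε (hnoise.integral_le hsecond) hψ hδ hδl hδt hα N _ _
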